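/- All graphs are finite and simple. For a family $\mathcal F$ of graphs, a graph is $\mathcal F$-free if it contains no member of $\mathcal F$ as a (not necessarily induced) subgraph, and $\mathrm{ex}(n,\mathcal F)$ denotes the maximal number of edges in an $\mathcal F$-free graph on $n$ vertices. Let $C_m$ denote the cycle of length $m$, and put $\mathcal C^{\rm even}_{2k}=\{C_4,C_6,\ldots,C_{2k}\}$ and $\mathcal C_k=\{C_3,C_4,\ldots,C_k\}$ (so $\mathcal C_2=\emptyset$). **Theorem.** Let $k\ge 2$ and $n\ge 1$ be integers. Then $$\mathrm{ex}\bigl(n,\mathcal C^{\rm even}_{2k}\cup\mathcal C_k\bigr)\le \tfrac12 n^{1+1/k}+\tfrac{k-1}{2k}\,n+n^{1-1/k}.$$ Furthermore, for each $k\in\{2,3,5\}$ there are infinitely many positive integers $n$ such that $$\mathrm{ex}\bigl(n,\mathcal C^{\rm even}_{2k}\cup\mathcal C_k\bigr)\ge \tfrac12 n^{1+1/k}+\tfrac{k-1}{2k}\,n-n^{1-1/k}.$$ -/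

import Mathlib

/-- A family of (isomorphism types of) finite graphs: a set of graphs on vertex sets `Fin m`. -/
abbrev GraphFamily : Type := Set (Σ m : ℕ, SimpleGraph (Fin m))

/-- `G` is `F`-free: no member of `F` is isomorphic to a (not necessarily induced) subgraph
of `G`. -/
def GraphFamily.Free (F : GraphFamily) {V : Type*} (G : SimpleGraph V) : Prop :=
  ∀ H ∈ F, H.2.Free G

open Classical in
/-- The Turán number `ex(n, F)`: the maximal number of edges of an `F`-free graph
on `n` vertices. -/
noncomputable def GraphFamily.turanNumber (n : ℕ) (F : GraphFamily) : ℕ :=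
  Finset.sup {G : SimpleGraph (Fin n) | F.Free G} (fun G => G.edgeFinset.card)

/-- The family `{C₄, C₆, …, C_m}` of all even cycles of length at most `m`. -/
def evenCyclesUpTo (m : ℕ) : GraphFamily :=
  {H | ∃ l : ℕ, 4 ≤ l ∧ l ≤ m ∧ Even l ∧ H = ⟨l, SimpleGraph.cycleGraph l⟩}

/-- The family `{C₃, C₄, …, C_m}` of all cycles of length at most `m`. -/
def cyclesUpTo (m : ℕ) : GraphFamily :=
  {H | ∃ l : ℕ, 3 ≤ l ∧ l ≤ m ∧ H = ⟨l, SimpleGraph.cycleGraph l⟩}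

/-!
The upper bound. A tour is a closed walk without backtracking. If a graph has a tour of even length
`2 * j ≤ 2 * k`, then a shortest segment of the tour with equal ends is a cycle; it is either the
whole tour or has length at most `j ≤ k`, because its complement is also such a segment. So a graph
free of the forbidden cycles has no such tours (`not_free_of_isTour`), and hence at most one walk of
length `k` without backtracking joins a given ordered pair of vertices. On the other hand, if all
degrees are at least two and the average degree is `d`, then there are at least
`n * d * (d - 1) ^ (k - 1)` walks of length `k` without backtracking, by the method of Alon, Hoory
and Linial: the sum of the logarithms of the numbers of continuations is bounded from below by
Jensen's inequality. This yields `d * (d - 1) ^ (k - 1) ≤ n`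
(`SimpleGraph.mul_sub_one_pow_le_card`), and solving for `d` gives the bound. Vertices of degree at
most one can be removed, as the bound grows by at least one with each vertex.

The lower bound. The extremal graphs are polarity graphs of generalized `(k + 1)`-gons: the
projective plane over a field with `q` elements for `k = 2`, the symplectic quadrangle in
characteristic two for `k = 3`, and the split Cayley hexagon in characteristic three for `k = 5`;
in the last two cases the polarity exists because the Frobenius endomorphism has a square root `σ`.
They have `n = 1 + q + ⋯ + q ^ k` vertices, and each point is incident with `q + 1` lines, so that
the number of edges is `(q + 1) * n / 2` up to half of the number of absolute points. All of this is
done in coordinates. The vertices are the vectors of length at most `k` over the field, a vertex is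
joined to its one-coordinate extensions, and vectors of full length are joined if they satisfy
an explicit system of equations, which is symmetric because of the polarity. An even tour in the
polarity graph is a closed path in the incidence graph, on which collineations act, the action on
points and the action on lines being used alternately. Root elations and one collineation that
interchanges two lines through a point suffice to move every incident pair to the pair at the root
of the tree, and from there a closed path would have to descend the whole tree on both sides
(`IsPolarTree.not_isTour`).
-/

/-! ### Closed walks without backtracking and short cycles -/

/-- A closed walk of length `m` of the relation `R` without backtracking, written as a periodic
sequence. Steps `x → x` are allowed if `R x x`. -/
structure IsTour {V : Type*} (R : V → V → Prop) (m : ℕ) (f : ℕ → V) : Prop where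
  periodic : ∀ i, f (i + m) = f i
  step : ∀ i, R (f i) (f (i + 1))
  noBacktrack : ∀ i, f i ≠ f (i + 2)

namespace IsTour

variable {V : Type*} {R : V → V → Prop} {m : ℕ} {f : ℕ → V}

lemma add_mul (hf : IsTour R m f) (i c : ℕ) : f (i + m * c) = f i := by
  induction c with
  | zero => simp
  | succ c ih => rw [Nat.mul_succ, ← add_assoc, hf.periodic, ih]

lemma shift (hf : IsTour R m f) (a : ℕ) : IsTour R m (fun i => f (i + a)) where
  periodic i := by rw [add_right_comm, hf.periodic]
  step i := by simpa only [add_right_comm] using hf.step (i + a)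
  noBacktrack i := by simpa only [add_right_comm] using hf.noBacktrack (i + a)

/-- The tour traversed backwards, starting with the same edge. -/
lemma reverse (hR : ∀ x y, R x y → R y x) (hf : IsTour R m f) (hm : 1 ≤ m) :
    IsTour R m (fun i => f ((m - 1) * i + 1)) := by
  obtain ⟨m, rfl⟩ := Nat.exists_eq_add_of_le' hm
  simp only [Nat.add_sub_cancel]
  refine ⟨fun i => ?_, fun i => hR _ _ ?_, fun i h => ?_⟩
  · rw [← hf.add_mul (m * i + 1) m]; congr 1; ring
  · have h := hf.step (m * (i + 1) + 1)
    rw [← hf.add_mul (m * i + 1) 1]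
    convert h using 2; ring
  · refine hf.noBacktrack (m * (i + 2) + 1) ?_
    rw [← h, ← hf.add_mul (m * i + 1) 2]; congr 1; ring

/-- A pair of injective maps which together carry `R` into `R` carries tours of even length
to tours: one map acts on the even, the other on the odd positions. -/
lemma map_pair (hR : ∀ x y, R x y → R y x) {j : ℕ} (hf : IsTour R (2 * j) f) {g h : V → V}
    (hg : Function.Injective g) (hh : Function.Injective h)
    (hgh : ∀ x y, R x y → R (g x) (h y)) :
    IsTour R (2 * j) (fun i => if Even i then g (f i) else h (f i)) := by
  refine ⟨fun i => ?_, fun i => ?_, fun i => ?_⟩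
  · simp [hf.periodic, Nat.even_add]
  · by_cases hi : Even i
    · simpa [hi, Nat.even_add_one] using hgh _ _ (hf.step i)
    · simpa [hi, Nat.even_add_one] using hR _ _ (hgh _ _ (hR _ _ (hf.step i)))
  · by_cases hi : Even i
    · simpa [hi, Nat.even_add] using fun e => hf.noBacktrack i (hg e)
    · simpa [hi, Nat.even_add] using fun e => hf.noBacktrack i (hh e)

end IsTour

section Cycles

variable {V : Type*} {G : SimpleGraph V}

lemma cycleGraph_isContained_of_closed {c : ℕ} (hc : 3 ≤ c) {f : ℕ → V}
    (hadj : ∀ i, G.Adj (f i) (f (i + 1))) (hclose : f c = f 0)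
    (hinj : ∀ i j, i < j → j < c → f i ≠ f j) : (SimpleGraph.cycleGraph c).IsContained G := by
  obtain ⟨c, rfl⟩ := Nat.exists_eq_add_of_le' hc
  have key : ∀ u v : Fin (c + 3), v = u + 1 → G.Adj (f u) (f v) := by
    rintro u v rfl
    rw [Fin.val_add_one]
    split_ifs with h
    · have := hadj u
      rw [h, Fin.val_last] at this
      rw [h, Fin.val_last]; rwa [hclose] at this
    · exact hadj u
  refine ⟨⟨⟨fun u => f u, fun {u v} huv => ?_⟩, fun u v huv => ?_⟩⟩
  · rw [SimpleGraph.cycleGraph_adj] at huv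
    rcases huv with h | h
    · exact (key v u (by rw [← h]; abel)).symm
    · exact key u v (by rw [← h]; abel)
  · by_contra hne
    rcases lt_or_gt_of_ne (fun e => hne (Fin.ext e) : (u : ℕ) ≠ v) with h | h
    · exact hinj _ _ h v.2 huv
    · exact hinj _ _ h u.2 huv.symm

/-- Walking around a cycle of length `l` is a tour of every length `m` divisible by `l`. An odd
cycle will be traversed twice. -/
lemma isTour_of_cycleGraph_isContained {l m : ℕ} (hl : 3 ≤ l) (hm : l ∣ m)
    (h : (SimpleGraph.cycleGraph l).IsContained G) : ∃ f, IsTour G.Adj m f := by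
  obtain ⟨⟨φ, hφ⟩⟩ := h
  obtain ⟨l, rfl⟩ := Nat.exists_eq_add_of_le' hl
  obtain ⟨c, rfl⟩ := hm
  refine ⟨fun i => φ (Fin.ofNat (l + 3) i), fun i => ?_, fun i => ?_, fun i h => ?_⟩
  · congr 1; ext; simp [Fin.ofNat]
  · apply φ.map_rel
    rw [SimpleGraph.cycleGraph_adj]
    right
    rw [sub_eq_iff_eq_add]
    ext; simp [Fin.ofNat, Fin.val_add, add_comm]
  · have := congrArg Fin.val (hφ h)
    simp only [Fin.ofNat] at this
    have h2 : (i + 0) ≡ (i + 2) [MOD (l + 3)] := this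
    have h3 := Nat.ModEq.add_left_cancel' i h2
    have h4 : 2 % (l + 3) = 2 := Nat.mod_eq_of_lt (by omega)
    simp [Nat.ModEq, h4] at h3

/-- A shortest segment `f i, …, f (i + c)` of a tour with equal ends is a cycle. As the complement
of a segment is a segment, either `c` is the whole period `2j`, or `c ≤ j`. -/
lemma not_free_of_isTour {k j : ℕ} (hj : 1 ≤ j) (hjk : j ≤ k) {f : ℕ → V}
    (hf : IsTour G.Adj (2 * j) f) : ¬ (evenCyclesUpTo (2 * k) ∪ cyclesUpTo k).Free G := by
  classical
  intro hfree
  have hex : ∃ c, 0 < c ∧ ∃ i, f (i + c) = f i := ⟨2 * j, by omega, 0, hf.periodic 0⟩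
  set c := Nat.find hex with hc
  obtain ⟨hc0, i, hi⟩ := Nat.find_spec hex
  rw [← hc] at hc0 hi
  have hmin : ∀ d, d < c → 0 < d → ∀ i, f (i + d) ≠ f i := fun d hd hd0 i h =>
    Nat.find_min hex hd ⟨hd0, i, h⟩
  have hcle : c ≤ 2 * j := Nat.find_min' hex ⟨by omega, 0, hf.periodic 0⟩
  have hc3 : 3 ≤ c := by
    by_contra hlt
    obtain h | h : c = 1 ∨ c = 2 := by omega
    · rw [h] at hi
      exact (hf.step i).ne hi.symm
    · rw [h] at hi
      exact hf.noBacktrack i hi.symm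
  have hcyc : (SimpleGraph.cycleGraph c).IsContained G := by
    refine cycleGraph_isContained_of_closed hc3 (f := fun t => f (t + i))
      (fun t => (hf.shift i).step t) (by simpa [add_comm] using hi) fun a b hab hb h => ?_
    refine hmin (b - a) (by omega) (by omega) (a + i) ?_
    rw [show a + i + (b - a) = b + i by omega]; exact h.symm
  by_cases hcj : c = 2 * j
  · refine hfree ⟨c, SimpleGraph.cycleGraph c⟩ (Or.inl ⟨c, ?_, by omega, ?_, rfl⟩) hcyc
    · omega
    · rw [hcj]; simp
  · have : c ≤ 2 * j - c := by
      by_contra hlt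
      refine hmin (2 * j - c) (by omega) (by omega) (i + c) ?_
      rw [hi, show i + c + (2 * j - c) = i + 2 * j by omega, hf.periodic]
    exact hfree ⟨c, SimpleGraph.cycleGraph c⟩ (Or.inr ⟨c, hc3, by omega, rfl⟩) hcyc

lemma free_of_forall_not_isTour {k : ℕ}
    (h : ∀ j f, 1 ≤ j → j ≤ k → ¬ IsTour G.Adj (2 * j) f) :
    (evenCyclesUpTo (2 * k) ∪ cyclesUpTo k).Free G := by
  rintro H (⟨l, hl4, hlk, ⟨j, rfl⟩, rfl⟩ | ⟨l, hl3, hlk, rfl⟩) hcon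
  · obtain ⟨f, hf⟩ := isTour_of_cycleGraph_isContained (m := 2 * j) (by omega)
      (by rw [two_mul]) hcon
    exact h j f (by omega) (by omega) hf
  · obtain ⟨f, hf⟩ := isTour_of_cycleGraph_isContained (m := 2 * l) hl3 (dvd_mul_left _ _) hcon
    exact h l f (by omega) hlk hf

end Cycles

/-! ### Counting walks without backtracking -/

lemma IsTour.of_mod {V : Type*} {R : V → V → Prop} {m : ℕ} (hm : 2 ≤ m) {F : ℕ → V}
    (h0 : F m = F 0) (h1 : F (m + 1) = F 1) (hstep : ∀ i < m, R (F i) (F (i + 1)))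
    (hnb : ∀ i < m, F i ≠ F (i + 2)) : IsTour R m (fun i => F (i % m)) := by
  have hlt : ∀ i, i % m < m := fun i => Nat.mod_lt _ (by omega)
  have e1 : ∀ i, F ((i + 1) % m) = F (i % m + 1) := fun i => by
    rw [← Nat.mod_add_mod]
    rcases Nat.lt_or_ge (i % m + 1) m with h | h
    · rw [Nat.mod_eq_of_lt h]
    · rw [show i % m + 1 = m by have := hlt i; omega, Nat.mod_self, h0]
  have e2 : ∀ i, F ((i + 2) % m) = F (i % m + 2) := fun i => by
    rw [show i + 2 = i + 1 + 1 by ring, e1, ← Nat.mod_add_mod]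
    rcases Nat.lt_or_ge (i % m + 1) m with h | h
    · rw [Nat.mod_eq_of_lt h]
    · rw [show i % m + 1 = m by have := hlt i; omega, Nat.mod_self,
        show i % m + 2 = m + 1 by have := hlt i; omega, h1]
  refine ⟨fun i => by simp, fun i => ?_, fun i => ?_⟩
  · simp only [e1]; exact hstep _ (hlt i)
  · simp only [e2]; exact hnb _ (hlt i)

namespace SimpleGraph

variable {V : Type*} (G : SimpleGraph V)

/-- `G` has no closed walk without backtracking whose length is even and at most `2 * k`. -/
def NoShortTour (k : ℕ) : Prop := ∀ j f, 1 ≤ j → j ≤ k → ¬ IsTour G.Adj (2 * j) f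

variable {G}

/-- Two different walks without backtracking with the same ends and the same length `m`, leaving
the initial vertex by different edges, give a tour: go along both of them until they first meet
after equally many steps. -/
lemma exists_isTour_of_two_walks (m : ℕ) (p q : ℕ → V) (h0 : p 0 = q 0)
    (h1 : p 1 ≠ q 1) (hm : 1 ≤ m) (he : p m = q m) (hp : ∀ i < m, G.Adj (p i) (p (i + 1)))
    (hq : ∀ i < m, G.Adj (q i) (q (i + 1))) (hp' : ∀ i, i + 2 ≤ m → p i ≠ p (i + 2))
    (hq' : ∀ i, i + 2 ≤ m → q i ≠ q (i + 2)) :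
    ∃ j f, 1 ≤ j ∧ j ≤ m ∧ IsTour G.Adj (2 * j) f := by
  induction m with
  | zero => omega
  | succ m ih =>
    have hm0 : m ≠ 0 := by rintro rfl; exact h1 he
    by_cases hpq : p m = q m
    · obtain ⟨j, f, hj, hjm, hf⟩ := ih (by omega) hpq (fun i hi => hp i (by omega))
        (fun i hi => hq i (by omega)) (fun i hi => hp' i (by omega)) (fun i hi => hq' i (by omega))
      exact ⟨j, f, hj, by omega, hf⟩
    · set F : ℕ → V := fun i => if i ≤ m + 1 then p i else
        if i ≤ 2 * (m + 1) then q (2 * (m + 1) - i) else p (i - 2 * (m + 1)) with hF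
      have F1 : ∀ i, i ≤ m + 1 → F i = p i := fun i hi => by simp [hF, hi]
      have F2 : ∀ i, i ≤ m + 1 → F (2 * (m + 1) - i) = q i := fun i hi => by
        by_cases him : i = m + 1
        · rw [F1 _ (by omega), him, ← he]; congr 1; omega
        · simp only [hF]
          rw [if_neg (by omega), if_pos (by omega)]; congr 1; omega
      have F3 : F (2 * (m + 1) + 1) = p 1 := by
        simp only [hF]
        rw [if_neg (by omega), if_neg (by omega)]; congr 1; omega
      refine ⟨m + 1, _, by omega, le_rfl, IsTour.of_mod (F := F) (by omega) ?_ ?_ ?_ ?_⟩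
      · rw [F1 0 (by omega), h0]; exact F2 0 (by omega)
      · rw [F3, F1 1 (by omega)]
      · intro i hi
        by_cases him : i < m + 1
        · rw [F1 _ (by omega), F1 _ (by omega)]; exact hp i him
        · have a := F2 (2 * (m + 1) - i) (by omega)
          have b := F2 (2 * (m + 1) - (i + 1)) (by omega)
          rw [Nat.sub_sub_self (by omega)] at a b
          rw [a, b, show 2 * (m + 1) - i = 2 * (m + 1) - (i + 1) + 1 by omega]
          exact (hq _ (by omega)).symm
      · intro i hi
        by_cases him : i + 2 ≤ m + 1
        · rw [F1 _ (by omega), F1 _ (by omega)]; exact hp' i him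
        · by_cases him' : i = m
          · have b := F2 m (by omega)
            rw [show 2 * (m + 1) - m = i + 2 by omega] at b
            rw [b, F1 _ (by omega), him']; exact hpq
          · have a := F2 (2 * (m + 1) - i) (by omega)
            rw [Nat.sub_sub_self (by omega)] at a
            by_cases hlast : i = 2 * m + 1
            · rw [a, show i + 2 = 2 * (m + 1) + 1 by omega, F3,
                show 2 * (m + 1) - i = 1 by omega]
              exact h1.symm
            · have b := F2 (2 * (m + 1) - (i + 2)) (by omega)
              rw [Nat.sub_sub_self (by omega)] at b
              rw [a, b, show 2 * (m + 1) - i = 2 * (m + 1) - (i + 2) + 2 by omega]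
              exact (hq' _ (by omega)).symm

variable [Fintype V] [DecidableEq V] (G) [DecidableRel G.Adj]

/-- The end vertices of the walks of length `j + 1` without backtracking that start with the step
from `u` to `v`. -/
def walkEnds : ℕ → V → V → Finset V
  | 0, _, v => {v}
  | j + 1, u, v => ((G.neighborFinset v).erase u).biUnion fun w => walkEnds j v w

variable {G}

lemma exists_walk_of_mem_walkEnds {j : ℕ} {u v z : V} (huv : G.Adj u v)
    (hz : z ∈ G.walkEnds j u v) : ∃ p : ℕ → V, p 0 = u ∧ p 1 = v ∧ p (j + 1) = z ∧
      (∀ i < j + 1, G.Adj (p i) (p (i + 1))) ∧ ∀ i, i + 2 ≤ j + 1 → p i ≠ p (i + 2) := by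
  induction j generalizing u v with
  | zero =>
    simp only [walkEnds, Finset.mem_singleton] at hz
    refine ⟨fun i => if i = 0 then u else v, by simp, by simp, by simp [hz], ?_, ?_⟩
    · intro i hi
      obtain rfl : i = 0 := by omega
      simpa using huv
    · intro i hi; omega
  | succ j ih =>
    simp only [walkEnds, Finset.mem_biUnion, Finset.mem_erase, mem_neighborFinset] at hz
    obtain ⟨w, ⟨hwu, hvw⟩, hz⟩ := hz
    obtain ⟨p, h0, h1, he, hadj, hnb⟩ := ih hvw hz
    refine ⟨fun i => if i = 0 then u else p (i - 1), by simp, by simp [h0], by simp [he], ?_, ?_⟩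
    · rintro (_ | i) hi
      · simpa [h0] using huv
      · simpa using hadj i (by omega)
    · rintro (_ | i) hi
      · simpa [h1] using hwu.symm
      · simpa using hnb i (by omega)

lemma disjoint_walkEnds {k j : ℕ} (hG : G.NoShortTour k) (hj : j + 1 ≤ k) {v w w' : V}
    (hw : G.Adj v w) (hw' : G.Adj v w') (hne : w ≠ w') :
    Disjoint (G.walkEnds j v w) (G.walkEnds j v w') := by
  rw [Finset.disjoint_left]
  intro z hz hz'
  obtain ⟨p, p0, p1, pe, padj, pnb⟩ := exists_walk_of_mem_walkEnds hw hz
  obtain ⟨q, q0, q1, qe, qadj, qnb⟩ := exists_walk_of_mem_walkEnds hw' hz'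
  obtain ⟨i, f, hi, hij, hf⟩ := exists_isTour_of_two_walks (j + 1) p q (by rw [p0, q0])
    (by rwa [p1, q1]) (by omega) (by rw [pe, qe]) padj qadj pnb qnb
  exact hG i f hi (by omega) hf

lemma card_walkEnds_succ {k j : ℕ} (hG : G.NoShortTour k) (hj : j + 1 ≤ k) (u v : V) :
    (G.walkEnds (j + 1) u v).card =
      ∑ w ∈ (G.neighborFinset v).erase u, (G.walkEnds j v w).card := by
  rw [walkEnds, Finset.card_biUnion]
  intro w hw w' hw' hne
  simp only [Finset.mem_coe, Finset.mem_erase, mem_neighborFinset] at hw hw'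
  exact disjoint_walkEnds hG hj hw.2 hw'.2 hne

lemma sum_card_walkEnds_le {k : ℕ} (hG : G.NoShortTour (k + 1)) (u : V) :
    ∑ v ∈ G.neighborFinset u, (G.walkEnds k u v).card ≤ Fintype.card V := by
  rw [← Finset.card_biUnion]
  · exact Finset.card_le_univ _
  · intro w hw w' hw' hne
    simp only [Finset.mem_coe, mem_neighborFinset] at hw hw'
    exact disjoint_walkEnds hG le_rfl hw hw' hne

lemma walkEnds_nonempty (hdeg : ∀ v, 2 ≤ G.degree v) (j : ℕ) {u v : V} (huv : G.Adj u v) :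
    (G.walkEnds j u v).Nonempty := by
  induction j generalizing u v with
  | zero => simp [walkEnds]
  | succ j ih =>
    have h : 0 < ((G.neighborFinset v).erase u).card := by
      rw [Finset.card_erase_of_mem (by simpa using huv.symm), card_neighborFinset_eq_degree]
      have := hdeg v
      omega
    obtain ⟨w, hw⟩ := Finset.card_pos.1 h
    obtain ⟨z, hz⟩ := ih (u := v) (v := w) (by simpa using (Finset.mem_erase.1 hw).2)
    exact ⟨z, Finset.mem_biUnion.2 ⟨w, hw, hz⟩⟩

end SimpleGraph

lemma sum_log_le_card_mul_log {ι : Type*} (s : Finset ι) (hs : s.Nonempty) (x : ι → ℝ)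
    (hx : ∀ i ∈ s, 0 < x i) :
    ∑ i ∈ s, Real.log (x i) ≤ s.card * Real.log ((∑ i ∈ s, x i) / s.card) := by
  have hc : (0 : ℝ) < s.card := by exact_mod_cast hs.card_pos
  have h := strictConcaveOn_log_Ioi.concaveOn.le_map_sum (t := s)
    (w := fun _ => (s.card : ℝ)⁻¹) (p := x) (fun _ _ => by positivity)
    (by simp [hc.ne']) (fun i hi => hx i hi)
  simp only [smul_eq_mul, ← Finset.mul_sum] at h
  rw [div_eq_inv_mul]
  calc ∑ i ∈ s, Real.log (x i) = s.card * ((s.card : ℝ)⁻¹ * ∑ i ∈ s, Real.log (x i)) := by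
        field_simp
    _ ≤ _ := by gcongr

lemma sum_sum_log_le {ι : Type*} [Fintype ι] (N : ι → Finset ι) (x : ι → ι → ℝ)
    (hx : ∀ u, ∀ v ∈ N u, 0 < x u v) {M : ℝ} (hM : ∑ u, ((N u).card : ℝ) = M) (hM0 : 0 < M) :
    0 < ∑ u, ∑ v ∈ N u, x u v ∧
      ∑ u, ∑ v ∈ N u, Real.log (x u v) ≤ M * Real.log ((∑ u, ∑ v ∈ N u, x u v) / M) := by
  have hcard : ((Finset.univ.sigma N).card : ℝ) = M := by
    rw [Finset.card_sigma, ← hM, Nat.cast_sum]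
  have hne : (Finset.univ.sigma N).Nonempty := by
    rw [← Finset.card_pos]; rw [← hcard] at hM0; exact_mod_cast hM0
  have hpos : ∀ y ∈ Finset.univ.sigma N, 0 < x y.1 y.2 := fun y hy =>
    hx _ _ (Finset.mem_sigma.1 hy).2
  have h := sum_log_le_card_mul_log _ hne _ hpos
  have h' := Finset.sum_pos hpos hne
  rw [hcard] at h
  rw [Finset.sum_sigma] at h h'
  rw [Finset.sum_sigma] at h
  exact ⟨h', h⟩

lemma convexOn_mul_log_sub_one :
    ConvexOn ℝ (Set.Ici 2) (fun x : ℝ => x * Real.log (x - 1)) := by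
  refine convexOn_of_hasDerivWithinAt2_nonneg (convex_Ici 2)
    (f' := fun x => Real.log (x - 1) + x * (1 / (x - 1)))
    (f'' := fun x => (x - 2) / (x - 1) ^ 2) ?_ ?_ ?_ ?_
  · refine continuousOn_id.mul (ContinuousOn.log (by fun_prop) ?_)
    intro x hx
    have : (2 : ℝ) ≤ x := hx
    linarith
  · intro x hx
    rw [interior_Ici] at hx
    have h1 : x - 1 ≠ 0 := by have : (2 : ℝ) < x := hx; linarith
    have h := (hasDerivAt_id x).mul (((hasDerivAt_id x).sub_const 1).log h1)
    refine (HasDerivAt.congr_deriv h ?_).hasDerivWithinAt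
    simp only [id]
    ring
  · intro x hx
    rw [interior_Ici] at hx
    have h1 : x - 1 ≠ 0 := by have : (2 : ℝ) < x := hx; linarith
    have h0 := (hasDerivAt_id x).sub_const 1
    have h := (h0.log h1).add ((hasDerivAt_id x).mul ((hasDerivAt_const x (1 : ℝ)).div h0 h1))
    refine (h.congr_deriv ?_).hasDerivWithinAt
    simp only [id, Pi.div_apply]
    field_simp
    ring
  · intro x hx
    rw [interior_Ici] at hx
    have : (2 : ℝ) < x := hx
    have : 0 ≤ x - 2 := by linarith
    positivity

namespace SimpleGraph

variable {V : Type*} [Fintype V] [DecidableEq V] {G : SimpleGraph V} [DecidableRel G.Adj]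

/-- By concavity of the logarithm, prolonging the walks by one step raises the sum of the logarithms
of the numbers of walks by at least `∑ v, deg v * log (deg v - 1)`. -/
lemma sum_log_walkEnds_succ_ge {k j : ℕ} (hG : G.NoShortTour k) (hj : j + 1 ≤ k)
    (hdeg : ∀ v, 2 ≤ G.degree v) :
    ∑ u, ∑ v ∈ G.neighborFinset u, Real.log (G.walkEnds j u v).card +
        ∑ v, (G.degree v : ℝ) * Real.log (G.degree v - 1) ≤
      ∑ u, ∑ v ∈ G.neighborFinset u, Real.log (G.walkEnds (j + 1) u v).card := by
  have hd : ∀ v, (0 : ℝ) < G.degree v - 1 := fun v => by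
    have : (2 : ℝ) ≤ G.degree v := by exact_mod_cast hdeg v
    linarith
  have hcard : ∀ {u v}, G.Adj v u →
      (((G.neighborFinset v).erase u).card : ℝ) = G.degree v - 1 := fun {u v} h => by
    rw [Finset.card_erase_of_mem (by simpa using h), card_neighborFinset_eq_degree,
      Nat.cast_sub (by have := hdeg v; omega), Nat.cast_one]
  have key : ∀ u v, G.Adj v u → Real.log (G.degree v - 1) + (G.degree v - 1 : ℝ)⁻¹ *
      ∑ w ∈ (G.neighborFinset v).erase u, Real.log (G.walkEnds j v w).card ≤
        Real.log (G.walkEnds (j + 1) u v).card := by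
    intro u v huv
    have hne : ((G.neighborFinset v).erase u).Nonempty := by
      rw [← Finset.card_pos]
      have h2 := hd v
      rw [← hcard huv] at h2
      exact_mod_cast h2
    have hpos : ∀ w ∈ (G.neighborFinset v).erase u, (0 : ℝ) < (G.walkEnds j v w).card := by
      intro w hw
      exact_mod_cast (walkEnds_nonempty hdeg j (by simpa using (Finset.mem_erase.1 hw).2)).card_pos
    have h := sum_log_le_card_mul_log _ hne _ hpos
    rw [hcard huv, ← Nat.cast_sum, ← card_walkEnds_succ hG hj, Real.log_div] at h
    · have h3 := mul_le_mul_of_nonneg_left h (inv_nonneg.2 (hd v).le)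
      rw [← mul_assoc, inv_mul_cancel₀ (hd v).ne', one_mul] at h3
      linarith
    · exact_mod_cast (walkEnds_nonempty hdeg (j + 1) huv.symm).card_pos.ne'
    · exact (hd v).ne'
  have hswap : ∀ φ : V → V → ℝ, ∑ u, ∑ v ∈ G.neighborFinset u, φ u v =
      ∑ v, ∑ u ∈ G.neighborFinset v, φ u v := fun φ =>
    Finset.sum_comm' (by intro u v; simp [G.adj_comm])
  rw [hswap (fun u v => Real.log (G.walkEnds (j + 1) u v).card), ← Finset.sum_add_distrib]
  refine Finset.sum_le_sum fun v _ => ?_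
  refine le_trans (le_of_eq ?_) (Finset.sum_le_sum fun u hu => key u v (by simpa using hu))
  rw [Finset.sum_add_distrib, Finset.sum_const, card_neighborFinset_eq_degree, nsmul_eq_mul,
    add_comm, ← Finset.mul_sum]
  congr 1
  -- each neighbour `w` of `v` can follow exactly `deg v - 1` of the steps into `v`
  rw [Finset.sum_comm' (t' := G.neighborFinset v) (s' := fun w => (G.neighborFinset v).erase w)
    (by intro u w; simp only [Finset.mem_erase, ne_eq, eq_comm]; tauto)]
  simp only [Finset.sum_const, nsmul_eq_mul]
  rw [Finset.mul_sum]
  refine Finset.sum_congr rfl fun w hw => ?_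
  rw [hcard (by simpa using hw), ← mul_assoc, inv_mul_cancel₀ (hd v).ne', one_mul]

/-- With `d` the average degree, a graph of minimum degree at least two without short even tours
satisfies `d * (d - 1) ^ k ≤ |V|`: the left side bounds from below the average number of walks of
length `k + 1` without backtracking from a vertex, and no two of them end at the same vertex. -/
lemma mul_sub_one_pow_le_card [Nonempty V] {k : ℕ} (hG : G.NoShortTour (k + 1))
    (hdeg : ∀ v, 2 ≤ G.degree v) {d : ℝ} (hd : d * Fintype.card V = 2 * G.edgeFinset.card) :
    2 ≤ d ∧ d * (d - 1) ^ k ≤ Fintype.card V := by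
  obtain ⟨n, hn⟩ : ∃ n : ℝ, n = (Fintype.card V : ℕ) := ⟨_, rfl⟩
  rw [← hn] at hd ⊢
  have hn0 : 0 < n := by rw [hn]; exact_mod_cast Fintype.card_pos
  have hM : ∑ v, (G.degree v : ℝ) = d * n := by
    rw [hd]; exact_mod_cast G.sum_degrees_eq_twice_card_edges
  have hdeg' : ∀ v, (2 : ℝ) ≤ G.degree v := fun v => by exact_mod_cast hdeg v
  have hd2 : 2 ≤ d := by
    have : ∑ v : V, (2 : ℝ) ≤ ∑ v, (G.degree v : ℝ) := Finset.sum_le_sum fun v _ => hdeg' v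
    rw [hM] at this
    simp only [Finset.sum_const, Finset.card_univ, nsmul_eq_mul, ← hn] at this
    nlinarith
  refine ⟨hd2, ?_⟩
  have hconv : d * n * Real.log (d - 1) ≤ ∑ v, (G.degree v : ℝ) * Real.log (G.degree v - 1) := by
    have h := convexOn_mul_log_sub_one.map_sum_le (t := (Finset.univ : Finset V))
      (w := fun _ => n⁻¹) (p := fun v => (G.degree v : ℝ)) (fun _ _ => by positivity)
      (by simp [← hn, hn0.ne']) (fun v _ => hdeg' v)
    simp only [smul_eq_mul, ← Finset.mul_sum, hM] at h
    rw [show n⁻¹ * (d * n) = d by field_simp] at h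
    have h2 := mul_le_mul_of_nonneg_left h hn0.le
    rw [← mul_assoc n n⁻¹, mul_inv_cancel₀ hn0.ne', one_mul] at h2
    linarith
  have hL : ∀ j ≤ k, j * (d * n * Real.log (d - 1)) ≤
      ∑ u, ∑ v ∈ G.neighborFinset u, Real.log (G.walkEnds j u v).card := by
    intro j hj
    induction j with
    | zero => simp [walkEnds]
    | succ j ih =>
      have h1 := ih (by omega)
      have h2 := sum_log_walkEnds_succ_ge (j := j) hG (by omega) hdeg
      push_cast
      linarith
  have hmem : ∀ u, ∀ v ∈ G.neighborFinset u, (0 : ℝ) < (G.walkEnds k u v).card := fun u v hv =>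
    Nat.cast_pos.2 (walkEnds_nonempty hdeg k ((G.mem_neighborFinset u v).1 hv)).card_pos
  have hcardS : ∑ u, ((G.neighborFinset u).card : ℝ) = d * n := by
    rw [← hM]; exact Finset.sum_congr rfl fun u _ => by rw [card_neighborFinset_eq_degree]
  have hMpos : 0 < d * n := by positivity
  have hN : ∑ u, ∑ v ∈ G.neighborFinset u, ((G.walkEnds k u v).card : ℝ) ≤ n * n := by
    calc _ ≤ ∑ u : V, n := Finset.sum_le_sum fun u _ => by
          rw [hn, ← Nat.cast_sum]; exact_mod_cast sum_card_walkEnds_le hG u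
      _ = n * n := by simp [hn]
  obtain ⟨hNpos, hlog⟩ := sum_sum_log_le _ _ hmem hcardS hMpos
  have h3 := (hL k le_rfl).trans hlog
  rw [show (k : ℝ) * (d * n * Real.log (d - 1)) = d * n * (k * Real.log (d - 1)) by ring] at h3
  have h4 := le_of_mul_le_mul_left h3 hMpos
  have hd1 : 0 < d - 1 := by linarith
  rw [← Real.log_pow] at h4
  have h5 := (Real.log_le_log_iff (pow_pos hd1 k) (div_pos hNpos hMpos)).1 h4
  rw [le_div_iff₀ hMpos] at h5
  refine le_of_mul_le_mul_left ?_ hn0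
  calc n * (d * (d - 1) ^ k) = (d - 1) ^ k * (d * n) := by ring
    _ ≤ n * n := h5.trans hN

end SimpleGraph

/-! ### The upper bound -/

/-- If `d * (d - 1) ^ k ≤ n` then `d` is at most about `n ^ (1 / (k + 1)) + k / (k + 1)`. -/
lemma le_of_mul_sub_one_pow_le {k : ℕ} {d r n : ℝ} (hd : 2 ≤ d) (hr : 0 < r)
    (hrn : r ^ (k + 1) = n) (h : d * (d - 1) ^ k ≤ n) : d ≤ r + k / (k + 1) + 1 / r := by
  obtain ⟨D, rfl⟩ : ∃ D, d = D + 1 := ⟨d - 1, by ring⟩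
  rw [add_sub_cancel_right] at h
  have hD : 1 ≤ D := by linarith
  have hk : (0 : ℝ) ≤ k := Nat.cast_nonneg k
  rcases le_or_gt (D + 1) r with hle | hlt
  · have : 0 ≤ (k : ℝ) / (k + 1) + 1 / r := by positivity
    linarith
  · -- Bernoulli's inequality gives `D / t ≤ r`
    set t : ℝ := 1 - 1 / ((k + 1) * (D + 1)) with ht
    have hte : t = ((k + 1) * D + k) / ((k + 1) * (D + 1)) := by
      rw [ht]; field_simp; ring
    have ht0 : 0 < t := by rw [hte]; positivity
    have hB := one_add_mul_le_pow (a := -(1 / ((k + 1) * (D + 1)))) (by linarith) (k + 1)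
    rw [← sub_eq_add_neg, ← ht] at hB
    have hB' : D / (D + 1) ≤ t ^ (k + 1) := by
      refine le_trans (le_of_eq ?_) hB
      push_cast
      field_simp
      ring
    have hpow : (D / t) ^ (k + 1) ≤ r ^ (k + 1) := by
      rw [div_pow, div_le_iff₀ (by positivity), hrn]
      calc D ^ (k + 1) = (D + 1) * D ^ k * (D / (D + 1)) := by rw [pow_succ]; field_simp
        _ ≤ n * t ^ (k + 1) := by
            gcongr
            exact hrn ▸ by positivity
    have hr' : D / t ≤ r := le_of_pow_le_pow_left₀ (Nat.succ_ne_zero k) hr.le hpow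
    have e : D / t = D + 1 - k / (k + 1) - k / ((k + 1) * ((k + 1) * D + k)) := by
      rw [hte]; field_simp; ring
    have hs : k / ((k + 1) * ((k + 1) * D + k)) ≤ 1 / r := by
      rw [div_le_div_iff₀ (by positivity) hr]
      nlinarith [mul_le_mul_of_nonneg_left hlt.le hk, mul_nonneg hk hk,
        mul_nonneg hk (by linarith : 0 ≤ D), mul_nonneg (mul_nonneg hk hk) (by linarith : 0 ≤ D)]
    linarith

/-- The upper bound for the number of edges as a function of the number of vertices. -/
noncomputable def edgeBound (k : ℕ) (x : ℝ) : ℝ :=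
  1 / 2 * x ^ (1 + 1 / (k : ℝ)) + ((k : ℝ) - 1) / (2 * (k : ℝ)) * x + x ^ (1 - 1 / (k : ℝ))

lemma edgeBound_nonneg {k : ℕ} (hk : 1 ≤ k) {x : ℝ} (hx : 0 ≤ x) : 0 ≤ edgeBound k x := by
  have : (0 : ℝ) ≤ (k : ℝ) - 1 := by
    have : (1 : ℝ) ≤ k := by exact_mod_cast hk
    linarith
  unfold edgeBound
  positivity

lemma edgeBound_add_one_le {k : ℕ} (hk : 1 ≤ k) {x : ℝ} (hx : 1 ≤ x) :
    edgeBound k x + 1 ≤ edgeBound k (x + 1) := by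
  have hk1 : (1 : ℝ) ≤ k := by exact_mod_cast hk
  have hx0 : 0 < x := by linarith
  have h1 : x ^ (1 - 1 / (k : ℝ)) ≤ (x + 1) ^ (1 - 1 / (k : ℝ)) := by
    refine Real.rpow_le_rpow hx0.le (by linarith) ?_
    rw [sub_nonneg, div_le_one (by positivity)]
    exact hk1
  have h2 : x ^ (1 + 1 / (k : ℝ)) + (1 + 1 / (k : ℝ)) ≤ (x + 1) ^ (1 + 1 / (k : ℝ)) := by
    set p : ℝ := 1 + 1 / (k : ℝ) with hp
    have hp1 : 1 ≤ p := by rw [hp, le_add_iff_nonneg_right]; positivity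
    have hB := one_add_mul_self_le_rpow_one_add (s := 1 / x) (by
      have : 0 < 1 / x := by positivity
      linarith) hp1
    have e : (x + 1) ^ p = x ^ p * (1 + 1 / x) ^ p := by
      rw [← Real.mul_rpow hx0.le (by positivity)]
      congr 1; field_simp
    have hxp : x ≤ x ^ p := by
      simpa using Real.rpow_le_rpow_of_exponent_le hx hp1
    calc x ^ p + p ≤ x ^ p + p * (x ^ p / x) := by
          gcongr
          refine le_mul_of_one_le_right (by linarith) ?_
          rwa [one_le_div hx0]
      _ = x ^ p * (1 + p * (1 / x)) := by ring
      _ ≤ _ := by rw [e]; gcongr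
  have h3 : ((k : ℝ) - 1) / (2 * k) + 1 / 2 * (1 + 1 / (k : ℝ)) = 1 := by
    field_simp; ring
  unfold edgeBound
  linarith

lemma half_mul_le_edgeBound {k : ℕ} {d x : ℝ} (hx : 0 < x) (hd : 2 ≤ d)
    (h : d * (d - 1) ^ k ≤ x) : 1 / 2 * (d * x) ≤ edgeBound (k + 1) x := by
  set r : ℝ := x ^ (1 / ((k + 1 : ℕ) : ℝ)) with hr
  have hr0 : 0 < r := by positivity
  have hrn : r ^ (k + 1) = x := by
    rw [hr, ← Real.rpow_natCast, ← Real.rpow_mul hx.le, one_div,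
      inv_mul_cancel₀ (by positivity), Real.rpow_one]
  have hle := le_of_mul_sub_one_pow_le hd hr0 hrn h
  rw [edgeBound, Real.rpow_add hx, Real.rpow_sub hx, Real.rpow_one, ← hr]
  push_cast
  calc 1 / 2 * (d * x) ≤ 1 / 2 * ((r + k / (k + 1) + 1 / r) * x) := by gcongr
    _ = 1 / 2 * (x * r) + (k + 1 - 1) / (2 * (k + 1)) * x + 1 / 2 * (x / r) := by
        field_simp; ring
    _ ≤ _ := by
        have : 0 ≤ x / r := by positivity
        linarith

namespace SimpleGraph

lemma NoShortTour.induce {V : Type*} {G : SimpleGraph V} {k : ℕ} (hG : G.NoShortTour k)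
    (s : Set V) : (G.induce s).NoShortTour k := fun j f hj hjk hf =>
  hG j (fun i => f i) hj hjk
    ⟨fun i => by rw [hf.periodic], fun i => hf.step i,
      fun i h => hf.noBacktrack i (Subtype.ext h)⟩

open Classical in
/-- Vertices of degree at most one are removed one by one; `edgeBound` decreases by at least
one in each removal. -/
lemma card_edgeFinset_le_edgeBound {k : ℕ} (n : ℕ) (V : Type*) [Fintype V]
    (hcard : Fintype.card V = n + 1) (G : SimpleGraph V) (hG : G.NoShortTour (k + 1)) :
    (G.edgeFinset.card : ℝ) ≤ edgeBound (k + 1) (n + 1) := by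
  induction n generalizing V with
  | zero =>
    have : G.edgeFinset.card = 0 := by
      have := G.card_edgeFinset_le_card_choose_two
      rw [hcard] at this
      simpa using this
    rw [this, Nat.cast_zero]
    exact edgeBound_nonneg (by omega) (by positivity)
  | succ n ih =>
    by_cases hdeg : ∀ v, 2 ≤ G.degree v
    · have hc : (Fintype.card V : ℝ) = (n + 1 : ℕ) + 1 := by rw [hcard]; push_cast; ring
      have : Nonempty V := Fintype.card_pos_iff.1 (by omega)
      have hpos : (0 : ℝ) < (n + 1 : ℕ) + 1 := by positivity
      have hd : (2 * G.edgeFinset.card / ((n + 1 : ℕ) + 1) : ℝ) * Fintype.card V =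
          2 * G.edgeFinset.card := by
        rw [hc]; field_simp
      obtain ⟨h2, h⟩ := mul_sub_one_pow_le_card hG hdeg hd
      have := half_mul_le_edgeBound (by rw [hc]; exact hpos) h2 h
      rw [hd, hc] at this
      linarith
    · push Not at hdeg
      obtain ⟨v, hv⟩ := hdeg
      have hcard' : Fintype.card ({v}ᶜ : Set V) = n + 1 := by
        rw [Fintype.card_compl_set, hcard]; simp
      have h1 : ((G.induce {v}ᶜ).edgeFinset.card : ℝ) ≤ edgeBound (k + 1) (n + 1) := by
        convert ih _ hcard' (G.induce {v}ᶜ) (hG.induce _)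
      have h2 : G.edgeFinset.card ≤ (G.induce {v}ᶜ).edgeFinset.card + 1 := by
        have e1 := card_edgeFinset_induce_compl_singleton G v
        have e2 := card_edgeFinset_deleteIncidenceSet G v
        have : (G.induce {v}ᶜ).edgeFinset.card = G.edgeFinset.card - G.degree v := by
          rw [← e2, ← e1]
        omega
      have h3 := edgeBound_add_one_le (k := k + 1) (by omega) (x := (n : ℝ) + 1)
        (by have : (0 : ℝ) ≤ n := by positivity
            linarith)
      have h4 : (G.edgeFinset.card : ℝ) ≤ (G.induce {v}ᶜ).edgeFinset.card + 1 := by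
        exact_mod_cast h2
      push_cast
      linarith

end SimpleGraph

open Classical in
theorem turanNumber_le_edgeBound {k n : ℕ} (hk : 1 ≤ k) (hn : 1 ≤ n) :
    (GraphFamily.turanNumber n (evenCyclesUpTo (2 * k) ∪ cyclesUpTo k) : ℝ) ≤ edgeBound k n := by
  obtain ⟨k, rfl⟩ := Nat.exists_eq_add_of_le' hk
  obtain ⟨n, rfl⟩ := Nat.exists_eq_add_of_le' hn
  refine (Nat.le_floor_iff (edgeBound_nonneg hk (by positivity))).1 ?_
  refine Finset.sup_le fun G hG => ?_
  rw [Nat.le_floor_iff (edgeBound_nonneg hk (by positivity))]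
  rw [Finset.mem_filter] at hG
  push_cast
  refine SimpleGraph.card_edgeFinset_le_edgeBound n _ (Fintype.card_fin _) G ?_
  exact fun j f hj hjk hf => not_free_of_isTour hj hjk hf hG.2

/-! ### Relations that look like a tree from every incident pair -/

section PolarTree

variable {V : Type*}

/-- The pair `(x, y)` can be moved to `(root, root)` by a pair of injective maps `g`, `h` which
together preserve `R`. For a polarity graph, `g` and `h` are the actions of a collineation on the
points and on the lines, the latter being identified with points through the polarity. -/
def MovableToRoot (R : V → V → Prop) (root x y : V) : Prop :=
  ∃ g h : V → V, Function.Injective g ∧ Function.Injective h ∧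
    (∀ a b, R a b → R (g a) (h b)) ∧ g x = root ∧ h y = root

lemma MovableToRoot.of_map {R : V → V → Prop} {root x y : V} {g h : V → V}
    (hg : Function.Injective g) (hh : Function.Injective h) (hgh : ∀ a b, R a b → R (g a) (h b))
    (H : MovableToRoot R root (g x) (h y)) : MovableToRoot R root x y := by
  obtain ⟨g', h', hg', hh', hgh', hx, hy⟩ := H
  exact ⟨g' ∘ g, h' ∘ h, hg'.comp hg, hh'.comp hh, fun a b r => hgh' _ _ (hgh _ _ r), hx, hy⟩

/-- A symmetric relation `R` that looks, from a vertex `root` with `R root root`, like a tree of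
depth `k` with additional pairs between its leaves, and in which every pair of the form
`(root, y)` can be moved to `(root, root)`. This is the shape of the polarity graph of a generalized
`(k + 1)`-gon seen from an absolute point. -/
structure IsPolarTree (R : V → V → Prop) (k : ℕ) (root : V) (parent : V → V) (lvl : V → ℕ) :
    Prop where
  symm : ∀ x y, R x y → R y x
  parent_root : parent root = root
  lvl_root : lvl root = 0
  rel_parent : ∀ x, R x (parent x)
  lvl_parent : ∀ x, x ≠ root → lvl (parent x) < lvl x
  eq_parent_or : ∀ x y, lvl x < k → R x y → y = parent x ∨ lvl y = lvl x + 1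
  movable : ∀ y, R root y → MovableToRoot R root root y

namespace IsPolarTree

variable {R : V → V → Prop} {k : ℕ} {root : V} {parent : V → V} {lvl : V → ℕ}

lemma movableToRoot (T : IsPolarTree R k root parent lvl) {x y : V} (hxy : R x y) :
    MovableToRoot R root x y := by
  have step : ∀ x y z, MovableToRoot R root x y → R x z → MovableToRoot R root x z := by
    rintro x y z ⟨g, h, hg, hh, hgh, hx, -⟩ hxz
    refine MovableToRoot.of_map hg hh hgh ?_
    rw [hx]
    exact T.movable _ (hx ▸ hgh _ _ hxz)
  have swap : ∀ x y, MovableToRoot R root x y → MovableToRoot R root y x := by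
    rintro x y ⟨g, h, hg, hh, hgh, hx, hy⟩
    exact ⟨h, g, hh, hg, fun a b r => T.symm _ _ (hgh _ _ (T.symm _ _ r)), hy, hx⟩
  have main : ∀ n x, lvl x = n → ∃ y, MovableToRoot R root x y := by
    intro n
    induction n using Nat.strong_induction_on with
    | _ n ih =>
      rintro x rfl
      by_cases hx : x = root
      · have := T.rel_parent root
        rw [T.parent_root] at this
        exact ⟨root, hx ▸ T.movable root this⟩
      · obtain ⟨y, hy⟩ := ih _ (T.lvl_parent x hx) (parent x) rfl
        exact ⟨parent x, swap _ _ (step _ _ _ hy (T.symm _ _ (T.rel_parent x)))⟩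
  obtain ⟨z, hz⟩ := main _ x rfl
  exact step _ _ _ hz hxy

/-- A tour starting with the step from the root to itself descends the tree. -/
lemma lvl_of_isTour (T : IsPolarTree R k root parent lvl) {m : ℕ} {f : ℕ → V}
    (hf : IsTour R m f) (h0 : f 0 = root) (h1 : f 1 = root) (i : ℕ) (hi : i ≤ k) :
    lvl (f (i + 1)) = i ∧ (i < k → f i = parent (f (i + 1))) := by
  induction i with
  | zero => simp [h0, h1, T.lvl_root, T.parent_root]
  | succ i ih =>
    obtain ⟨hl, hp⟩ := ih (by omega)
    have hlvl : lvl (f (i + 1 + 1)) = i + 1 := by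
      rcases T.eq_parent_or _ _ (by omega) (hf.step (i + 1)) with h | h
      · rw [← hp (by omega)] at h
        exact absurd h.symm (hf.noBacktrack i)
      · rw [h, hl]
    refine ⟨hlvl, fun hik => ?_⟩
    rcases T.eq_parent_or _ _ (by omega) (T.symm _ _ (hf.step (i + 1))) with h | h
    · exact h
    · omega

/-- A tour of length at most `2 * k` may be assumed to contain the step from the root to itself.
From there it descends the tree in both directions, so that its two halves cannot meet. -/
lemma not_isTour (T : IsPolarTree R k root parent lvl) {j : ℕ} (hj : 1 ≤ j) (hjk : j ≤ k)
    (f : ℕ → V) : ¬ IsTour R (2 * j) f := by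
  intro hf₀
  obtain ⟨g, h, hg, hh, hgh, hx, hy⟩ := T.movableToRoot (hf₀.step 0)
  have hf := hf₀.map_pair T.symm hg hh hgh
  set F := fun i => if Even i then g (f i) else h (f i)
  have F0 : F 0 = root := by simpa [F] using hx
  have F1 : F 1 = root := by simpa [F] using hy
  have hr := hf.reverse T.symm (by omega)
  have e : ∀ i, (2 * j - 1) * (i + 1) + 1 + i = 2 * j * (i + 1) := fun i => by
    obtain ⟨j, rfl⟩ := Nat.exists_eq_add_of_le' hj
    rw [show 2 * (j + 1) - 1 = 2 * j + 1 by omega]; ring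
  have a := (T.lvl_of_isTour hf F0 F1 j hjk).1
  have b := (T.lvl_of_isTour hr (by simpa using F1) (by
    have := hf.periodic 0
    rw [zero_add] at this
    rw [mul_one, show 2 * j - 1 + 1 = 2 * j by omega, this, F0]) (j - 1) (by omega)).1
  -- Position `j + 1` is reached forwards at level `j`, and backwards at level `j - 1`.
  have c : (2 * j - 1) * (j - 1 + 1) + 1 = j + 1 + 2 * j * (j - 1) := by
    obtain ⟨j, rfl⟩ := Nat.exists_eq_add_of_le' hj
    rw [show 2 * (j + 1) - 1 = 2 * j + 1 by omega, Nat.add_sub_cancel]; ring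
  simp only [c, hf.add_mul] at b
  omega

end IsPolarTree

open Classical in
/-- The graph of a symmetric relation without short tours, with its loops dropped, has
many edges if the relation has large neighbourhoods and few loops. -/
lemma card_mul_le_two_mul_turanNumber [Fintype V] {R : V → V → Prop} {k q L : ℕ}
    (hsymm : ∀ x y, R x y → R y x)
    (hR : ∀ j f, 1 ≤ j → j ≤ k → ¬ IsTour R (2 * j) f)
    (hdeg : ∀ x, q + 1 ≤ (Finset.univ.filter fun y => R x y).card)
    (hloop : (Finset.univ.filter fun x => R x x).card ≤ L) :
    (q + 1) * Fintype.card V ≤ 2 * GraphFamily.turanNumber (Fintype.card V)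
      (evenCyclesUpTo (2 * k) ∪ cyclesUpTo k) + L := by
  set G : SimpleGraph V := SimpleGraph.fromRel R with hG
  have hadj : ∀ x y, G.Adj x y → R x y := fun x y h => by
    rw [hG, SimpleGraph.fromRel_adj] at h
    exact h.2.elim id (hsymm _ _)
  set G' := G.overFin rfl with hG'
  let φ : G ≃g G' := G.overFinIso rfl
  have hfree : (evenCyclesUpTo (2 * k) ∪ cyclesUpTo k).Free G' := by
    refine free_of_forall_not_isTour fun j f hj hjk hf => hR j (fun i => φ.symm (f i)) hj hjk ?_
    exact ⟨fun i => by rw [hf.periodic], fun i => hadj _ _ (φ.symm.map_rel_iff.2 (hf.step i)),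
      fun i h => hf.noBacktrack i (φ.symm.injective h)⟩
  have hle : G.edgeFinset.card ≤ GraphFamily.turanNumber (Fintype.card V)
      (evenCyclesUpTo (2 * k) ∪ cyclesUpTo k) := by
    rw [φ.card_edgeFinset_eq]
    refine le_trans (le_of_eq ?_) (Finset.le_sup
      (f := fun G : SimpleGraph (Fin (Fintype.card V)) => G.edgeFinset.card)
      (Finset.mem_filter.2 ⟨Finset.mem_univ G', hfree⟩))
    convert rfl
  have hsum := G.sum_degrees_eq_twice_card_edges
  have hx : ∀ x, q + 1 ≤ G.degree x + if R x x then 1 else 0 := by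
    intro x
    refine (hdeg x).trans ?_
    rw [← SimpleGraph.card_neighborFinset_eq_degree]
    by_cases hxx : R x x
    · rw [if_pos hxx, ← Finset.card_insert_of_notMem (G.notMem_neighborFinset_self x)]
      refine Finset.card_le_card fun y hy => ?_
      rw [Finset.mem_insert, SimpleGraph.mem_neighborFinset, hG, SimpleGraph.fromRel_adj]
      by_cases hyx : y = x
      · exact Or.inl hyx
      · exact Or.inr ⟨Ne.symm hyx, Or.inl (Finset.mem_filter.1 hy).2⟩
    · rw [if_neg hxx, add_zero]
      refine Finset.card_le_card fun y hy => ?_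
      have hy' := (Finset.mem_filter.1 hy).2
      rw [SimpleGraph.mem_neighborFinset, hG, SimpleGraph.fromRel_adj]
      exact ⟨by rintro rfl; exact hxx hy', Or.inl hy'⟩
  have hall := Finset.sum_le_sum fun x (_ : x ∈ (Finset.univ : Finset V)) => hx x
  rw [Finset.sum_const, Finset.sum_add_distrib, hsum, ← Finset.card_filter, smul_eq_mul,
    Finset.card_univ] at hall
  rw [mul_comm]
  omega

/-- The neighbourhoods of `R` contain injective images of `Option F`: think of `none` as the
parent, and of the elements of `F` as the children or the neighbours in the affine part. -/
lemma card_add_one_le_card_filter {F : Type*} [Fintype F] [Fintype V] {R : V → V → Prop}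
    [DecidableRel R] (nbr : Option F → V) (x : V) (hinj : Function.Injective nbr)
    (hnbr : ∀ o, R x (nbr o)) :
    Fintype.card F + 1 ≤ (Finset.univ.filter fun y => R x y).card := by
  classical
  rw [← Fintype.card_option, ← Finset.card_univ, ← Finset.card_image_of_injective _ hinj]
  refine Finset.card_le_card fun y hy => ?_
  obtain ⟨o, -, rfl⟩ := Finset.mem_image.1 hy
  simpa using hnbr o

lemma card_filter_le_of_subset_range {ι : Type*} [Fintype ι] [Fintype V] {p : V → Prop}
    [DecidablePred p] (φ : ι → V) (hφ : ∀ x, p x → x ∈ Set.range φ) :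
    (Finset.univ.filter p).card ≤ Fintype.card ι := by
  classical
  refine (Finset.card_le_card fun x hx => ?_).trans (Finset.card_image_le
    (s := Finset.univ) (f := φ))
  simpa using hφ x (by simpa using hx)

end PolarTree

/-! ### The polarity graph of the split Cayley hexagon -/

/-- The vertices of the polarity graph of the split Cayley hexagon: coordinate vectors of length at
most five. A vertex stands for a point, and through the polarity also for a line. -/
inductive HexVertex (F : Type*)
  | root : HexVertex F
  | c1 (x₁ : F) : HexVertex F
  | c2 (x₁ x₂ : F) : HexVertex F
  | c3 (x₁ x₂ x₃ : F) : HexVertex F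
  | c4 (x₁ x₂ x₃ x₄ : F) : HexVertex F
  | c5 (x₁ x₂ x₃ x₄ x₅ : F) : HexVertex F

namespace HexVertex

variable {F : Type*}

/-- Deletion of the last coordinate. -/
def parent : HexVertex F → HexVertex F
  | root => root
  | c1 _ => root
  | c2 a _ => c1 a
  | c3 a b _ => c2 a b
  | c4 a b c _ => c3 a b c
  | c5 a b c d _ => c4 a b c d

/-- The number of coordinates. -/
def lvl : HexVertex F → ℕ
  | root => 0
  | c1 _ => 1
  | c2 _ _ => 2
  | c3 _ _ _ => 3
  | c4 _ _ _ _ => 4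
  | c5 _ _ _ _ _ => 5

/-- The vertices as a disjoint union of powers of `F`. -/
def equivSum : HexVertex F ≃ Option (F ⊕ F × F ⊕ F × F × F ⊕ F × F × F × F ⊕
    F × F × F × F × F) where
  toFun
    | root => none
    | c1 a => some (.inl a)
    | c2 a b => some (.inr (.inl (a, b)))
    | c3 a b c => some (.inr (.inr (.inl (a, b, c))))
    | c4 a b c d => some (.inr (.inr (.inr (.inl (a, b, c, d)))))
    | c5 a b c d e => some (.inr (.inr (.inr (.inr (a, b, c, d, e)))))
  invFun
    | none => root
    | some (.inl a) => c1 a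
    | some (.inr (.inl (a, b))) => c2 a b
    | some (.inr (.inr (.inl (a, b, c)))) => c3 a b c
    | some (.inr (.inr (.inr (.inl (a, b, c, d))))) => c4 a b c d
    | some (.inr (.inr (.inr (.inr (a, b, c, d, e))))) => c5 a b c d e
  left_inv x := by cases x <;> rfl
  right_inv x := by rcases x with _ | _ | _ | _ | _ | _ <;> rfl

instance [Fintype F] : Fintype (HexVertex F) := Fintype.ofEquiv _ equivSum.symm

lemma card_eq [Fintype F] {q : ℕ} (hq : Fintype.card F = q) :
    Fintype.card (HexVertex F) = 1 + q + q ^ 2 + q ^ 3 + q ^ 4 + q ^ 5 := by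
  rw [Fintype.card_congr equivSum]
  simp only [Fintype.card_option, Fintype.card_sum, Fintype.card_prod, hq]
  ring

variable [Field F]

/-- Incidence of the vertices with five coordinates. In the usual coordinates, and in
characteristic three, the point `(a, l, a', l', a'')` and the line `[k, b, k', b', k'']` are incident
if `k'' = a³k + l`, `a'' = ak + b`, `k' = a³k² + l' - kl` and `b' = a²k + a' + aa''`. Here the
point is `(x₁, σ x₂, x₃, σ x₄, x₅)` and the line is `[σ y₁, y₂, σ y₃, y₄, σ y₅]`, which makes the
system symmetric. -/
def Affine (σ : F →+* F) : HexVertex F → HexVertex F → Prop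
  | c5 x₁ x₂ x₃ x₄ x₅, c5 y₁ y₂ y₃ y₄ y₅ =>
      y₅ = σ x₁ * y₁ + x₂ ∧ x₅ = σ y₁ * x₁ + y₂ ∧
      y₃ = σ x₁ * y₁ ^ 2 + x₄ - y₁ * x₂ ∧ x₃ = σ y₁ * x₁ ^ 2 + y₄ - x₁ * y₂
  | _, _ => False

/-- Incidence of a point with a line of the hexagon, with lines written as the images of points
under the polarity. Here `σ` is a square root of the Frobenius endomorphism in characteristic
three. -/
def Rel (σ : F →+* F) (x y : HexVertex F) : Prop :=
  y = x.parent ∨ x = y.parent ∨ Affine σ x y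

/-- The action on the points of the root elation that fixes all points on the line `root` and sends
the line `c1 0` to `c1 u`. -/
def elation (σ : F →+* F) (u : F) : HexVertex F → HexVertex F
  | root => root
  | c1 a => c1 a
  | c2 k b => c2 (k + u) b
  | c3 a l a' => c3 a (l - σ a * u) (a' + a ^ 2 * σ u)
  | c4 k b k' b' => c4 (k + u) b k' b'
  | c5 a l a' l' a'' => c5 a (l - σ a * u) (a' + a ^ 2 * σ u) (l' + u * l + σ a * u ^ 2)
      (a'' + a * σ u)

/-- The action of the same elation on the lines. -/
def elationLine (σ : F →+* F) (u : F) : HexVertex F → HexVertex F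
  | root => root
  | c1 k => c1 (k + u)
  | c2 a l => c2 a (l - σ a * u)
  | c3 k b k' => c3 (k + u) b k'
  | c4 a l a' l' => c4 a (l - σ a * u) (a' + a ^ 2 * σ u) (l' + u * l + σ a * u ^ 2)
  | c5 k b k' b' k'' => c5 (k + u) b k' b' k''

open Classical in
/-- The action on the points of a collineation that fixes the point `root` and interchanges
the lines `root` and `c1 0`. -/
noncomputable def flip (σ : F →+* F) : HexVertex F → HexVertex F
  | root => root
  | c1 a => c2 0 (-a)
  | c2 k b => if k = 0 then c1 b else c2 (-k⁻¹) (b / σ k)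
  | c3 a l a' => c4 0 (-a) (-l) a'
  | c4 k b k' b' => if k = 0 then c3 b k' b' else
      c4 (-k⁻¹) (b / σ k) (σ b / k ^ 2 + k' / k) (b' - b ^ 2 / σ k)
  | c5 a l a' l' a'' => c5 a'' l' (a' + a * a'') (-l) (-a)

open Classical in
/-- The action of the same collineation on the lines. -/
noncomputable def flipLine (σ : F →+* F) : HexVertex F → HexVertex F
  | root => c1 0
  | c1 k => if k = 0 then root else c1 (-k⁻¹)
  | c2 a l => c3 0 (-a) (-l)
  | c3 k b k' => if k = 0 then c2 b k' else c3 (-k⁻¹) (b / σ k) (σ b / k ^ 2 + k' / k)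
  | c4 a l a' l' => c5 0 (-a) (-l) a' l'
  | c5 k b k' b' k'' => if k = 0 then c4 b k' b' (-k'') else
      c5 (-k⁻¹) (b / σ k) (σ b / k ^ 2 + k' / k) (b' - b ^ 2 / σ k) (k' + k * k'' - σ b / k)

lemma elation_injective (σ : F →+* F) (u : F) : Function.Injective (elation σ u) := by
  rintro (_ | _ | _ | _ | _ | _) (_ | _ | _ | _ | _ | _) h <;>
    simp only [elation, reduceCtorEq, c1.injEq, c2.injEq, c3.injEq, c4.injEq, c5.injEq] at h ⊢ <;>
    grind

lemma elationLine_injective (σ : F →+* F) (u : F) : Function.Injective (elationLine σ u) := by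
  rintro (_ | _ | _ | _ | _ | _) (_ | _ | _ | _ | _ | _) h <;>
    simp only [elationLine, reduceCtorEq, c1.injEq, c2.injEq, c3.injEq, c4.injEq, c5.injEq]
      at h ⊢ <;>
    grind

/-- The square of `flip`, an involution. -/
def negate : HexVertex F → HexVertex F
  | root => root
  | c1 a => c1 (-a)
  | c2 k b => c2 k (-b)
  | c3 a l a' => c3 (-a) (-l) a'
  | c4 k b k' b' => c4 k (-b) (-k') b'
  | c5 a l a' l' a'' => c5 (-a) (-l) a' (-l') (-a'')

/-- The square of `flipLine`, an involution. -/
def negateLine : HexVertex F → HexVertex F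
  | root => root
  | c1 k => c1 k
  | c2 a l => c2 (-a) (-l)
  | c3 k b k' => c3 k (-b) (-k')
  | c4 a l a' l' => c4 (-a) (-l) a' (-l')
  | c5 k b k' b' k'' => c5 k (-b) (-k') b' (-k'')

variable {σ : F →+* F}

lemma flip_injective (hσ : ∀ x, σ (σ x) = x ^ 3) : Function.Injective (flip σ) := by
  refine Function.LeftInverse.injective (g := fun x => negate (flip σ x)) ?_
  rintro (_ | _ | ⟨k, b⟩ | _ | ⟨k, b, k', b'⟩ | _)
  · simp [flip, negate]
  · simp [flip, negate]
  · by_cases hk : k = 0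
    · simp [flip, negate, hk]
    · have : σ k ≠ 0 := by simpa using hk
      simp [flip, negate, hk]
      field_simp
  · simp [flip, negate]
  · by_cases hk : k = 0
    · simp [flip, negate, hk]
    · have : σ k ≠ 0 := by simpa using hk
      simp [flip, negate, hk, hσ]
      refine ⟨?_, ?_, ?_⟩ <;> field_simp <;> ring
  · simp [flip, negate]; ring

lemma flipLine_injective [CharP F 3] (hσ : ∀ x, σ (σ x) = x ^ 3) :
    Function.Injective (flipLine σ) := by
  have h3 : (3 : F) = 0 := by exact_mod_cast CharP.cast_eq_zero F 3
  refine Function.LeftInverse.injective (g := fun x => negateLine (flipLine σ x)) ?_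
  rintro (_ | k | _ | ⟨k, b, k'⟩ | _ | ⟨k, b, k', b', k''⟩)
  · simp [flipLine, negateLine]
  · by_cases hk : k = 0
    · simp [flipLine, negateLine, hk]
    · simp [flipLine, negateLine, hk]
  · simp [flipLine, negateLine]
  · by_cases hk : k = 0
    · simp [flipLine, negateLine, hk]
    · have : σ k ≠ 0 := by simpa using hk
      simp [flipLine, negateLine, hk, hσ]
      refine ⟨?_, ?_⟩ <;> field_simp
      ring
  · simp [flipLine, negateLine]
  · by_cases hk : k = 0
    · simp [flipLine, negateLine, hk]
    · have : σ k ≠ 0 := by simpa using hk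
      simp [flipLine, negateLine, hk, hσ]
      refine ⟨?_, ?_, ?_, ?_⟩ <;> field_simp <;>
        first | ring1 | linear_combination (-σ b) * h3

lemma rel_elation [CharP F 3] (u : F) (x y : HexVertex F) (h : Rel σ x y) :
    Rel σ (elation σ u x) (elationLine σ u y) := by
  have h3 : (3 : F) = 0 := by exact_mod_cast CharP.cast_eq_zero F 3
  rcases h with rfl | rfl | h
  · left
    cases x <;> rfl
  · right; left
    cases y <;> rfl
  · right; right
    rcases x with _ | _ | _ | _ | _ | ⟨x₁, x₂, x₃, x₄, x₅⟩ <;>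
    rcases y with _ | _ | _ | _ | _ | ⟨y₁, y₂, y₃, y₄, y₅⟩ <;> try exact h.elim
    obtain ⟨e1, e2, e3, e4⟩ := h
    simp only [elation, elationLine, Affine, map_add]
    refine ⟨by linear_combination e1, by linear_combination e2, ?_, ?_⟩
    · linear_combination e3 - (σ x₁ * u ^ 2 + σ x₁ * u * y₁) * h3
    · linear_combination e4

lemma rel_flip [CharP F 3] (hσ : ∀ x, σ (σ x) = x ^ 3) (x y : HexVertex F) (h : Rel σ x y) :
    Rel σ (flip σ x) (flipLine σ y) := by
  have h3 : (3 : F) = 0 := by exact_mod_cast CharP.cast_eq_zero F 3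
  rcases h with rfl | rfl | h
  · rcases x with _ | _ | ⟨k, b⟩ | _ | ⟨k, b, k', b'⟩ | _
    · simp [flip, flipLine, Rel, parent]
    · simp [flip, flipLine, Rel, parent]
    · by_cases hk : k = 0 <;> simp [flip, flipLine, Rel, parent, hk]
    · simp [flip, flipLine, Rel, parent]
    · by_cases hk : k = 0 <;> simp [flip, flipLine, Rel, parent, hk]
    · simp [flip, flipLine, Rel, parent, Affine]
      ring
  · rcases y with _ | k | _ | ⟨k, b, k'⟩ | _ | ⟨k, b, k', b', k''⟩
    · simp [flip, flipLine, Rel, parent]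
    · by_cases hk : k = 0 <;> simp [flip, flipLine, Rel, parent, hk]
    · simp [flip, flipLine, Rel, parent]
    · by_cases hk : k = 0 <;> simp [flip, flipLine, Rel, parent, hk]
    · simp [flip, flipLine, Rel, parent]
    · by_cases hk : k = 0 <;> simp [flip, flipLine, Rel, parent, hk]
  · rcases x with _ | _ | _ | _ | _ | ⟨x₁, x₂, x₃, x₄, x₅⟩ <;>
    rcases y with _ | _ | _ | _ | _ | ⟨k, y₂, y₃, y₄, y₅⟩ <;> try exact h.elim
    obtain ⟨e1, e2, e3, e4⟩ := h
    by_cases hk : k = 0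
    · subst hk
      simp only [map_zero, mul_zero, zero_mul, zero_add] at e1 e2 e3 e4
      simp [flip, flipLine, Rel, parent, Affine]
      grind
    · have hk' : σ k ≠ 0 := by simpa using hk
      right; right
      simp only [flip, flipLine, Affine, hk, if_false, map_neg, map_inv₀, e2, map_add, map_mul, hσ,
        e1, e3, e4]
      refine ⟨?_, ?_, ?_, ?_⟩ <;> field_simp
      · linear_combination (k ^ 3 * σ x₁) * h3
      · ring
      · ring
      · linear_combination (σ k ^ 2 * x₁ ^ 2 + σ k * x₁ * y₂ + y₂ ^ 2) * h3

lemma rel_symm (x y : HexVertex F) (h : Rel σ x y) : Rel σ y x := by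
  rcases h with h | h | h
  · exact Or.inr (Or.inl h)
  · exact Or.inl h
  · right; right
    rcases x with _ | _ | _ | _ | _ | ⟨x₁, x₂, x₃, x₄, x₅⟩ <;>
    rcases y with _ | _ | _ | _ | _ | ⟨y₁, y₂, y₃, y₄, y₅⟩ <;> try exact h.elim
    obtain ⟨e1, e2, e3, e4⟩ := h
    exact ⟨e2, e1, e4, e3⟩

/-- The generalized hexagon property: the polarity graph has no short tours. -/
lemma isPolarTree [CharP F 3] (hσ : ∀ x, σ (σ x) = x ^ 3) :
    IsPolarTree (Rel σ) 5 root parent lvl where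
  symm := rel_symm
  parent_root := rfl
  lvl_root := rfl
  rel_parent x := Or.inl rfl
  lvl_parent x hx := by cases x <;> simp [parent, lvl] at hx ⊢
  eq_parent_or x y hx h := by
    rcases h with h | rfl | h
    · exact Or.inl h
    · cases y <;> simp [parent, lvl]
    · cases x <;> cases y <;> simp [Affine, lvl] at h hx
  movable y h := by
    have hflip : MovableToRoot (Rel σ) root root (c1 0) :=
      ⟨flip σ, flipLine σ, flip_injective hσ, flipLine_injective hσ, rel_flip hσ, rfl,
        by simp [flipLine]⟩
    cases y with
    | root => exact ⟨id, id, fun _ _ h => h, fun _ _ h => h, fun _ _ h => h, rfl, rfl⟩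
    | c1 t =>
      refine MovableToRoot.of_map (elation_injective σ (-t)) (elationLine_injective σ (-t))
        (rel_elation (-t)) ?_
      simpa [elation, elationLine] using hflip
    | _ => simp [Rel, parent, Affine] at h

/-- The neighbours of a vertex: the parent, and one more for each element of the field. -/
def neighbor (σ : F →+* F) (x : HexVertex F) : Option F → HexVertex F
  | none => x.parent
  | some t => match x with
    | root => c1 t
    | c1 a => c2 a t
    | c2 a b => c3 a b t
    | c3 a b c => c4 a b c t
    | c4 a b c d => c5 a b c d t
    | c5 a b c d e => c5 t (e - σ t * a) (σ a * t ^ 2 + d - t * b)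
        (c - σ t * a ^ 2 + a * (e - σ t * a)) (σ a * t + b)

lemma neighbor_injective (x : HexVertex F) : Function.Injective (neighbor σ x) := by
  cases x <;> rintro (_ | s) (_ | t) h <;> simp_all [neighbor, parent]

lemma rel_neighbor (x : HexVertex F) (o : Option F) : Rel σ x (neighbor σ x o) := by
  cases o with
  | none => exact Or.inl rfl
  | some t =>
    cases x with
    | c5 a b c d e =>
      right; right
      simp only [neighbor, Affine]
      refine ⟨trivial, ?_, trivial, ?_⟩ <;> ring
    | _ => exact Or.inr (Or.inl rfl)

/-- A parametrization of the absolute points, which are the loops of `Rel`. -/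
def absolute (σ : F →+* F) : Option (F × F × F) → HexVertex F
  | none => root
  | some (a, b, c) => c5 a b c (c - σ a * a ^ 2 + a * b) (σ a * a + b)

lemma mem_range_absolute {x : HexVertex F} (h : Rel σ x x) : x ∈ Set.range (absolute σ) := by
  cases x with
  | root => exact ⟨none, rfl⟩
  | c5 a b c d e =>
    simp only [Rel, parent, Affine, reduceCtorEq, false_or] at h
    obtain ⟨e1, -, e2, -⟩ := h
    refine ⟨some (a, b, c), ?_⟩
    simp only [absolute, c5.injEq, true_and]
    exact ⟨by linear_combination e2, e1.symm⟩
  | _ => simp [Rel, parent, Affine] at h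

end HexVertex

lemma le_turanNumber_of_char_three {F : Type*} [Field F] [Fintype F] [CharP F 3] {σ : F →+* F}
    (hσ : ∀ x, σ (σ x) = x ^ 3) {q n : ℕ} (hq : Fintype.card F = q)
    (hn : n = 1 + q + q ^ 2 + q ^ 3 + q ^ 4 + q ^ 5) :
    (q + 1) * n ≤ 2 * GraphFamily.turanNumber n (evenCyclesUpTo (2 * 5) ∪ cyclesUpTo 5) +
      (q ^ 3 + 1) := by
  classical
  rw [hn, ← HexVertex.card_eq hq]
  refine card_mul_le_two_mul_turanNumber (R := HexVertex.Rel σ) HexVertex.rel_symm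
    (fun j f hj hjk => (HexVertex.isPolarTree hσ).not_isTour hj hjk f) (fun x => ?_) ?_
  · rw [← hq]
    exact card_add_one_le_card_filter _ x (HexVertex.neighbor_injective (σ := σ) x)
      (HexVertex.rel_neighbor x)
  · refine (card_filter_le_of_subset_range (HexVertex.absolute σ)
      fun x => HexVertex.mem_range_absolute).trans (le_of_eq ?_)
    simp only [Fintype.card_option, Fintype.card_prod, hq]
    ring

/-! ### The polarity graph of the symplectic quadrangle -/

/-- The vertices of the polarity graph of the symplectic quadrangle: coordinate vectors of length at
most three. -/
inductive QuadVertex (F : Type*)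
  | root : QuadVertex F
  | c1 (x₁ : F) : QuadVertex F
  | c2 (x₁ x₂ : F) : QuadVertex F
  | c3 (x₁ x₂ x₃ : F) : QuadVertex F

namespace QuadVertex

variable {F : Type*}

/-- Deletion of the last coordinate. -/
def parent : QuadVertex F → QuadVertex F
  | root => root
  | c1 _ => root
  | c2 a _ => c1 a
  | c3 a b _ => c2 a b

/-- The number of coordinates. -/
def lvl : QuadVertex F → ℕ
  | root => 0
  | c1 _ => 1
  | c2 _ _ => 2
  | c3 _ _ _ => 3

/-- The vertices as a disjoint union of powers of `F`. -/
def equivSum : QuadVertex F ≃ Option (F ⊕ F × F ⊕ F × F × F) where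
  toFun
    | root => none
    | c1 a => some (.inl a)
    | c2 a b => some (.inr (.inl (a, b)))
    | c3 a b c => some (.inr (.inr (a, b, c)))
  invFun
    | none => root
    | some (.inl a) => c1 a
    | some (.inr (.inl (a, b))) => c2 a b
    | some (.inr (.inr (a, b, c))) => c3 a b c
  left_inv x := by cases x <;> rfl
  right_inv x := by rcases x with _ | _ | _ | _ <;> rfl

instance [Fintype F] : Fintype (QuadVertex F) := Fintype.ofEquiv _ equivSum.symm

lemma card_eq [Fintype F] {q : ℕ} (hq : Fintype.card F = q) :
    Fintype.card (QuadVertex F) = 1 + q + q ^ 2 + q ^ 3 := by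
  rw [Fintype.card_congr equivSum]
  simp only [Fintype.card_option, Fintype.card_sum, Fintype.card_prod, hq]
  ring

variable [Field F]

/-- Incidence of the vertices with three coordinates. In the usual coordinates, and in
characteristic two, the point `(a, l, a')` and the line `[k, b, k']` are incident if
`k' = a²k + l` and `a' = ak + b`. Here the point is `(x₁, σ x₂, x₃)` and the line is
`[σ y₁, y₂, σ y₃]`, which makes the system symmetric. -/
def Affine (σ : F →+* F) : QuadVertex F → QuadVertex F → Prop
  | c3 x₁ x₂ x₃, c3 y₁ y₂ y₃ => y₃ = σ x₁ * y₁ + x₂ ∧ x₃ = σ y₁ * x₁ + y₂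
  | _, _ => False

/-- Incidence of a point with a line of the quadrangle, with lines written as the images of points
under the polarity. Here `σ` is a square root of the Frobenius endomorphism in characteristic
two. -/
def Rel (σ : F →+* F) (x y : QuadVertex F) : Prop :=
  y = x.parent ∨ x = y.parent ∨ Affine σ x y

/-- The action on the points of the root elation that fixes all points on the line `root` and sends
the line `c1 0` to `c1 u`. -/
def elation (σ : F →+* F) (u : F) : QuadVertex F → QuadVertex F
  | root => root
  | c1 a => c1 a
  | c2 k b => c2 (k + u) b
  | c3 a l a' => c3 a (l - σ a * u) (a' + a * σ u)

/-- The action of the same elation on the lines. -/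
def elationLine (σ : F →+* F) (u : F) : QuadVertex F → QuadVertex F
  | root => root
  | c1 k => c1 (k + u)
  | c2 a l => c2 a (l - σ a * u)
  | c3 k b k' => c3 (k + u) b k'

open Classical in
/-- The action on the points of a collineation that fixes the point `root` and interchanges
the lines `root` and `c1 0`. -/
noncomputable def flip (σ : F →+* F) : QuadVertex F → QuadVertex F
  | root => root
  | c1 a => c2 0 a
  | c2 k b => if k = 0 then c1 b else c2 k⁻¹ (b / σ k)
  | c3 a l a' => c3 a' l a

open Classical in
/-- The action of the same collineation on the lines. -/
noncomputable def flipLine (σ : F →+* F) : QuadVertex F → QuadVertex F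
  | root => c1 0
  | c1 k => if k = 0 then root else c1 k⁻¹
  | c2 a l => c3 0 a l
  | c3 k b k' => if k = 0 then c2 b k' else c3 k⁻¹ (b / σ k) (k' + σ b / k)

lemma elation_injective (σ : F →+* F) (u : F) : Function.Injective (elation σ u) := by
  rintro (_ | _ | _ | _) (_ | _ | _ | _) h <;>
    simp only [elation, reduceCtorEq, c1.injEq, c2.injEq, c3.injEq] at h ⊢ <;>
    grind

lemma elationLine_injective (σ : F →+* F) (u : F) : Function.Injective (elationLine σ u) := by
  rintro (_ | _ | _ | _) (_ | _ | _ | _) h <;>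
    simp only [elationLine, reduceCtorEq, c1.injEq, c2.injEq, c3.injEq] at h ⊢ <;>
    grind

variable {σ : F →+* F}

lemma flip_injective : Function.Injective (flip σ) := by
  refine Function.LeftInverse.injective (g := flip σ) ?_
  rintro (_ | _ | ⟨k, b⟩ | _)
  · simp [flip]
  · simp [flip]
  · by_cases hk : k = 0
    · simp [flip, hk]
    · have : σ k ≠ 0 := by simpa using hk
      simp [flip, hk]
  · simp [flip]

lemma flipLine_injective [CharP F 2] (hσ : ∀ x, σ (σ x) = x ^ 2) :
    Function.Injective (flipLine σ) := by
  have h2 : (2 : F) = 0 := by exact_mod_cast CharP.cast_eq_zero F 2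
  refine Function.LeftInverse.injective (g := flipLine σ) ?_
  rintro (_ | k | _ | ⟨k, b, k'⟩)
  · simp [flipLine]
  · by_cases hk : k = 0 <;> simp [flipLine, hk]
  · simp [flipLine]
  · by_cases hk : k = 0
    · simp [flipLine, hk]
    · have : σ k ≠ 0 := by simpa using hk
      simp [flipLine, hk, hσ]
      field_simp
      linear_combination (σ b) * h2

lemma rel_elation (u : F) (x y : QuadVertex F) (h : Rel σ x y) :
    Rel σ (elation σ u x) (elationLine σ u y) := by
  rcases h with rfl | rfl | h
  · left
    cases x <;> rfl
  · right; left
    cases y <;> rfl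
  · right; right
    rcases x with _ | _ | _ | ⟨x₁, x₂, x₃⟩ <;>
    rcases y with _ | _ | _ | ⟨y₁, y₂, y₃⟩ <;> try exact h.elim
    obtain ⟨e1, e2⟩ := h
    simp only [elation, elationLine, Affine, map_add]
    exact ⟨by linear_combination e1, by linear_combination e2⟩

lemma rel_flip [CharP F 2] (hσ : ∀ x, σ (σ x) = x ^ 2) (x y : QuadVertex F) (h : Rel σ x y) :
    Rel σ (flip σ x) (flipLine σ y) := by
  have h2 : (2 : F) = 0 := by exact_mod_cast CharP.cast_eq_zero F 2
  rcases h with rfl | rfl | h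
  · rcases x with _ | _ | ⟨k, b⟩ | _
    · simp [flip, flipLine, Rel, parent]
    · simp [flip, flipLine, Rel, parent]
    · by_cases hk : k = 0 <;> simp [flip, flipLine, Rel, parent, hk]
    · simp [flip, flipLine, Rel, parent, Affine]
  · rcases y with _ | k | _ | ⟨k, b, k'⟩
    · simp [flip, flipLine, Rel, parent]
    · by_cases hk : k = 0 <;> simp [flip, flipLine, Rel, parent, hk]
    · simp [flip, flipLine, Rel, parent]
    · by_cases hk : k = 0 <;> simp [flip, flipLine, Rel, parent, hk]
  · rcases x with _ | _ | _ | ⟨x₁, x₂, x₃⟩ <;>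
    rcases y with _ | _ | _ | ⟨k, y₂, y₃⟩ <;> try exact h.elim
    obtain ⟨e1, e2⟩ := h
    by_cases hk : k = 0
    · subst hk
      simp only [map_zero, mul_zero, zero_mul, zero_add] at e1 e2
      simp [flip, flipLine, Rel, parent, Affine, e1, e2]
    · have hk' : σ k ≠ 0 := by simpa using hk
      right; right
      simp only [flip, flipLine, Affine, hk, if_false, map_inv₀, e2, map_add, map_mul, hσ, e1]
      refine ⟨?_, ?_⟩ <;> field_simp
      · ring
      · linear_combination (-y₂) * h2

lemma rel_symm (x y : QuadVertex F) (h : Rel σ x y) : Rel σ y x := by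
  rcases h with h | h | h
  · exact Or.inr (Or.inl h)
  · exact Or.inl h
  · right; right
    rcases x with _ | _ | _ | ⟨x₁, x₂, x₃⟩ <;>
    rcases y with _ | _ | _ | ⟨y₁, y₂, y₃⟩ <;> try exact h.elim
    exact h.symm

/-- The generalized quadrangle property: the polarity graph has no short tours. -/
lemma isPolarTree [CharP F 2] (hσ : ∀ x, σ (σ x) = x ^ 2) :
    IsPolarTree (Rel σ) 3 root parent lvl where
  symm := rel_symm
  parent_root := rfl
  lvl_root := rfl
  rel_parent x := Or.inl rfl
  lvl_parent x hx := by cases x <;> simp [parent, lvl] at hx ⊢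
  eq_parent_or x y hx h := by
    rcases h with h | rfl | h
    · exact Or.inl h
    · cases y <;> simp [parent, lvl]
    · cases x <;> cases y <;> simp [Affine, lvl] at h hx
  movable y h := by
    have hflip : MovableToRoot (Rel σ) root root (c1 0) :=
      ⟨flip σ, flipLine σ, flip_injective, flipLine_injective hσ, rel_flip hσ, rfl,
        by simp [flipLine]⟩
    cases y with
    | root => exact ⟨id, id, fun _ _ h => h, fun _ _ h => h, fun _ _ h => h, rfl, rfl⟩
    | c1 t =>
      refine MovableToRoot.of_map (elation_injective σ (-t)) (elationLine_injective σ (-t))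
        (rel_elation (-t)) ?_
      simpa [elation, elationLine] using hflip
    | _ => simp [Rel, parent, Affine] at h

/-- The neighbours of a vertex: the parent, and one more for each element of the field. -/
def neighbor (σ : F →+* F) (x : QuadVertex F) : Option F → QuadVertex F
  | none => x.parent
  | some t => match x with
    | root => c1 t
    | c1 a => c2 a t
    | c2 a b => c3 a b t
    | c3 a b c => c3 t (c - σ t * a) (σ a * t + b)

lemma neighbor_injective (x : QuadVertex F) : Function.Injective (neighbor σ x) := by
  cases x <;> rintro (_ | s) (_ | t) h <;> simp_all [neighbor, parent]

lemma rel_neighbor (x : QuadVertex F) (o : Option F) : Rel σ x (neighbor σ x o) := by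
  cases o with
  | none => exact Or.inl rfl
  | some t =>
    cases x with
    | c3 a b c =>
      right; right
      simp only [neighbor, Affine]
      exact ⟨trivial, by ring⟩
    | _ => exact Or.inr (Or.inl rfl)

/-- A parametrization of the absolute points, which are the loops of `Rel`. -/
def absolute (σ : F →+* F) : Option (F × F) → QuadVertex F
  | none => root
  | some (a, b) => c3 a b (σ a * a + b)

lemma mem_range_absolute {x : QuadVertex F} (h : Rel σ x x) : x ∈ Set.range (absolute σ) := by
  cases x with
  | root => exact ⟨none, rfl⟩
  | c3 a b c =>
    simp only [Rel, parent, Affine, reduceCtorEq, false_or] at h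
    exact ⟨some (a, b), by simp [absolute, h.1.symm]⟩
  | _ => simp [Rel, parent, Affine] at h

end QuadVertex

lemma le_turanNumber_of_char_two {F : Type*} [Field F] [Fintype F] [CharP F 2] {σ : F →+* F}
    (hσ : ∀ x, σ (σ x) = x ^ 2) {q n : ℕ} (hq : Fintype.card F = q)
    (hn : n = 1 + q + q ^ 2 + q ^ 3) :
    (q + 1) * n ≤ 2 * GraphFamily.turanNumber n (evenCyclesUpTo (2 * 3) ∪ cyclesUpTo 3) +
      (q ^ 2 + 1) := by
  classical
  rw [hn, ← QuadVertex.card_eq hq]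
  refine card_mul_le_two_mul_turanNumber (R := QuadVertex.Rel σ) QuadVertex.rel_symm
    (fun j f hj hjk => (QuadVertex.isPolarTree hσ).not_isTour hj hjk f) (fun x => ?_) ?_
  · rw [← hq]
    exact card_add_one_le_card_filter _ x (QuadVertex.neighbor_injective (σ := σ) x)
      (QuadVertex.rel_neighbor x)
  · refine (card_filter_le_of_subset_range (QuadVertex.absolute σ)
      fun x => QuadVertex.mem_range_absolute).trans (le_of_eq ?_)
    simp only [Fintype.card_option, Fintype.card_prod, hq]
    ring

/-! ### The polarity graph of the projective plane -/

/-- The vertices of the polarity graph of the projective plane: coordinate vectors of length at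
most two. -/
inductive PlaneVertex (F : Type*)
  | root : PlaneVertex F
  | c1 (x₁ : F) : PlaneVertex F
  | c2 (x₁ x₂ : F) : PlaneVertex F

namespace PlaneVertex

variable {F : Type*}

/-- Deletion of the last coordinate. -/
def parent : PlaneVertex F → PlaneVertex F
  | root => root
  | c1 _ => root
  | c2 a _ => c1 a

/-- The number of coordinates. -/
def lvl : PlaneVertex F → ℕ
  | root => 0
  | c1 _ => 1
  | c2 _ _ => 2

/-- The vertices as a disjoint union of powers of `F`. -/
def equivSum : PlaneVertex F ≃ Option (F ⊕ F × F) where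
  toFun
    | root => none
    | c1 a => some (.inl a)
    | c2 a b => some (.inr (a, b))
  invFun
    | none => root
    | some (.inl a) => c1 a
    | some (.inr (a, b)) => c2 a b
  left_inv x := by cases x <;> rfl
  right_inv x := by rcases x with _ | _ | _ <;> rfl

instance [Fintype F] : Fintype (PlaneVertex F) := Fintype.ofEquiv _ equivSum.symm

lemma card_eq [Fintype F] {q : ℕ} (hq : Fintype.card F = q) :
    Fintype.card (PlaneVertex F) = 1 + q + q ^ 2 := by
  rw [Fintype.card_congr equivSum]
  simp only [Fintype.card_option, Fintype.card_sum, Fintype.card_prod, hq]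
  ring

variable [Field F]

/-- Incidence of the vertices with two coordinates. -/
def Affine : PlaneVertex F → PlaneVertex F → Prop
  | c2 x₁ x₂, c2 y₁ y₂ => x₂ + y₂ = x₁ * y₁
  | _, _ => False

/-- Incidence of a point with a line of the plane, with lines written as the images of points
under the polarity. -/
def Rel (x y : PlaneVertex F) : Prop :=
  y = x.parent ∨ x = y.parent ∨ Affine x y

/-- The action on the points of the elation that fixes all points on the line `root` and sends
the line `c1 0` to `c1 u`. -/
def elation (u : F) : PlaneVertex F → PlaneVertex F
  | root => root
  | c1 a => c1 a
  | c2 k b => c2 (k + u) b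

/-- The action of the same elation on the lines. -/
def elationLine (u : F) : PlaneVertex F → PlaneVertex F
  | root => root
  | c1 k => c1 (k + u)
  | c2 a l => c2 a (l + a * u)

open Classical in
/-- The action on the points of a collineation that fixes the point `root` and interchanges
the lines `root` and `c1 0`. -/
noncomputable def flip : PlaneVertex F → PlaneVertex F
  | root => root
  | c1 a => c2 0 (-a)
  | c2 k b => if k = 0 then c1 (-b) else c2 k⁻¹ (-b / k)

open Classical in
/-- The action of the same collineation on the lines. -/
noncomputable def flipLine : PlaneVertex F → PlaneVertex F
  | root => c1 0
  | c1 k => if k = 0 then root else c1 k⁻¹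
  | c2 a l => c2 l a

lemma elation_injective (u : F) : Function.Injective (elation u) := by
  rintro (_ | _ | _) (_ | _ | _) h <;>
    simp only [elation, reduceCtorEq, c1.injEq, c2.injEq] at h ⊢ <;>
    grind

lemma elationLine_injective (u : F) : Function.Injective (elationLine u) := by
  rintro (_ | _ | _) (_ | _ | _) h <;>
    simp only [elationLine, reduceCtorEq, c1.injEq, c2.injEq] at h ⊢ <;>
    grind

lemma flip_injective : Function.Injective (flip (F := F)) := by
  refine Function.LeftInverse.injective (g := flip) ?_
  rintro (_ | _ | ⟨k, b⟩)
  · simp [flip]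
  · simp [flip]
  · by_cases hk : k = 0
    · simp [flip, hk]
    · simp [flip, hk]

lemma flipLine_injective : Function.Injective (flipLine (F := F)) := by
  refine Function.LeftInverse.injective (g := flipLine) ?_
  rintro (_ | k | _)
  · simp [flipLine]
  · by_cases hk : k = 0 <;> simp [flipLine, hk]
  · simp [flipLine]

lemma rel_elation (u : F) (x y : PlaneVertex F) (h : Rel x y) :
    Rel (elation u x) (elationLine u y) := by
  rcases h with rfl | rfl | h
  · left
    cases x <;> rfl
  · right; left
    cases y <;> rfl
  · right; right
    rcases x with _ | _ | ⟨x₁, x₂⟩ <;> rcases y with _ | _ | ⟨y₁, y₂⟩ <;> try exact h.elim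
    simp only [elation, elationLine, Affine] at h ⊢
    linear_combination h

lemma rel_flip (x y : PlaneVertex F) (h : Rel x y) : Rel (flip x) (flipLine y) := by
  rcases h with rfl | rfl | h
  · rcases x with _ | _ | ⟨k, b⟩
    · simp [flip, flipLine, Rel, parent]
    · simp [flip, flipLine, Rel, parent]
    · by_cases hk : k = 0 <;> simp [flip, flipLine, Rel, parent, hk]
  · rcases y with _ | k | _
    · simp [flip, flipLine, Rel, parent]
    · by_cases hk : k = 0 <;> simp [flip, flipLine, Rel, parent, hk]
    · simp [flip, flipLine, Rel, parent, Affine]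
  · rcases x with _ | _ | ⟨k, b⟩ <;> rcases y with _ | _ | ⟨a, l⟩ <;> try exact h.elim
    simp only [Affine] at h
    by_cases hk : k = 0
    · subst hk
      simp [flip, flipLine, Rel, parent, Affine]
      linear_combination -h
    · right; right
      simp only [flip, flipLine, Affine, hk, if_false]
      field_simp
      linear_combination -h

lemma rel_symm (x y : PlaneVertex F) (h : Rel x y) : Rel y x := by
  rcases h with h | h | h
  · exact Or.inr (Or.inl h)
  · exact Or.inl h
  · right; right
    rcases x with _ | _ | ⟨x₁, x₂⟩ <;> rcases y with _ | _ | ⟨y₁, y₂⟩ <;> try exact h.elim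
    simp only [Affine] at h ⊢
    linear_combination h

/-- The projective plane property: the polarity graph has no short tours. -/
lemma isPolarTree : IsPolarTree (Rel (F := F)) 2 root parent lvl where
  symm := rel_symm
  parent_root := rfl
  lvl_root := rfl
  rel_parent x := Or.inl rfl
  lvl_parent x hx := by cases x <;> simp [parent, lvl] at hx ⊢
  eq_parent_or x y hx h := by
    rcases h with h | rfl | h
    · exact Or.inl h
    · cases y <;> simp [parent, lvl]
    · cases x <;> cases y <;> simp [Affine, lvl] at h hx
  movable y h := by
    have hflip : MovableToRoot Rel root root (c1 (0 : F)) :=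
      ⟨flip, flipLine, flip_injective, flipLine_injective, rel_flip, rfl, by simp [flipLine]⟩
    cases y with
    | root => exact ⟨id, id, fun _ _ h => h, fun _ _ h => h, fun _ _ h => h, rfl, rfl⟩
    | c1 t =>
      refine MovableToRoot.of_map (elation_injective (-t)) (elationLine_injective (-t))
        (rel_elation (-t)) ?_
      simpa [elation, elationLine] using hflip
    | _ => simp [Rel, parent, Affine] at h

/-- The neighbours of a vertex: the parent, and one more for each element of the field. -/
def neighbor (x : PlaneVertex F) : Option F → PlaneVertex F
  | none => x.parent
  | some t => match x with
    | root => c1 t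
    | c1 a => c2 a t
    | c2 a b => c2 t (a * t - b)

lemma neighbor_injective (x : PlaneVertex F) : Function.Injective (neighbor x) := by
  cases x <;> rintro (_ | s) (_ | t) h <;> simp_all [neighbor, parent]

lemma rel_neighbor (x : PlaneVertex F) (o : Option F) : Rel x (neighbor x o) := by
  cases o with
  | none => exact Or.inl rfl
  | some t =>
    cases x with
    | c2 a b =>
      right; right
      simp [neighbor, Affine]
    | _ => exact Or.inr (Or.inl rfl)

/-- A parametrization, in odd characteristic, of the absolute points, which are the loops
of `Rel`. -/
def absolute : Option F → PlaneVertex F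
  | none => root
  | some a => c2 a (a ^ 2 / 2)

lemma mem_range_absolute (h2 : (2 : F) ≠ 0) {x : PlaneVertex F} (h : Rel x x) :
    x ∈ Set.range (absolute (F := F)) := by
  cases x with
  | root => exact ⟨none, rfl⟩
  | c2 a b =>
    simp only [Rel, parent, Affine, reduceCtorEq, false_or] at h
    refine ⟨some a, ?_⟩
    simp only [absolute, c2.injEq, true_and]
    field_simp
    linear_combination -h
  | _ => simp [Rel, parent, Affine] at h

end PlaneVertex

lemma le_turanNumber_of_odd_char {F : Type*} [Field F] [Fintype F] (h2 : (2 : F) ≠ 0)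
    {q n : ℕ} (hq : Fintype.card F = q) (hn : n = 1 + q + q ^ 2) :
    (q + 1) * n ≤ 2 * GraphFamily.turanNumber n (evenCyclesUpTo (2 * 2) ∪ cyclesUpTo 2) +
      (q + 1) := by
  classical
  rw [hn, ← PlaneVertex.card_eq hq]
  refine card_mul_le_two_mul_turanNumber (R := PlaneVertex.Rel (F := F)) PlaneVertex.rel_symm
    (fun j f hj hjk => PlaneVertex.isPolarTree.not_isTour hj hjk f) (fun x => ?_) ?_
  · rw [← hq]
    exact card_add_one_le_card_filter _ x (PlaneVertex.neighbor_injective x)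
      (PlaneVertex.rel_neighbor x)
  · refine (card_filter_le_of_subset_range PlaneVertex.absolute
      fun x => PlaneVertex.mem_range_absolute h2).trans (le_of_eq ?_)
    simp only [Fintype.card_option, hq]

/-! ### The lower bound -/

/-- In characteristic `p`, a field with `p ^ (2 * a + 1)` elements has an endomorphism whose square
is the Frobenius endomorphism, namely `x ↦ x ^ (p ^ (a + 1))`. -/
lemma exists_field_with_sqrt_frobenius (p : ℕ) [Fact p.Prime] (N : ℕ) :
    ∃ (F : Type) (_ : Field F) (_ : Fintype F) (_ : CharP F p) (σ : F →+* F),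
      (∀ x, σ (σ x) = x ^ p) ∧ N ≤ Fintype.card F := by
  have hp := (Fact.out : p.Prime)
  let F := GaloisField p (2 * N + 1)
  have : Fintype F := Fintype.ofFinite F
  have hcard : Fintype.card F = p ^ (2 * N + 1) := by
    rw [← Nat.card_eq_fintype_card]; exact GaloisField.card p _ (by omega)
  refine ⟨F, inferInstance, this, inferInstance, iterateFrobenius F p (N + 1), fun x => ?_, ?_⟩
  · rw [iterateFrobenius_def, iterateFrobenius_def, ← pow_mul, ← pow_add,
      show N + 1 + (N + 1) = 2 * N + 1 + 1 by ring, pow_succ p, pow_mul, ← hcard,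
      FiniteField.pow_card]
  · rw [hcard]
    exact (Nat.lt_pow_self hp.one_lt).le.trans (Nat.pow_le_pow_right hp.pos (by omega))

/-- A graph with `(q + 1) * n / 2` edges, up to a small loss `L / 2`, attains the lower bound if
`n ^ (1 / k)` is at most `q + 1 / k + 1 / (2 * q)`, which for large `q` holds for
`n = q ^ k + ⋯ + q + 1`. -/
lemma lower_bound_of_card {k q n T L : ℕ} (hk : 1 ≤ k) (hq : 1 ≤ q)
    (hT : (q + 1) * n ≤ 2 * T + L) (hqn : q ^ k ≤ n)
    (hn : (n : ℝ) ≤ (q + 1 / k + 1 / (2 * q)) ^ k)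
    (hL : (n : ℝ) + 2 * q * L ≤ 4 * q ^ k) :
    1 / 2 * (n : ℝ) ^ (1 + 1 / (k : ℝ)) + ((k : ℝ) - 1) / (2 * (k : ℝ)) * (n : ℝ)
      - (n : ℝ) ^ (1 - 1 / (k : ℝ)) ≤ T := by
  have hq0 : (0 : ℝ) < q := by exact_mod_cast hq
  have hk0 : (0 : ℝ) < k := by exact_mod_cast hk
  have hqn' : (q : ℝ) ^ k ≤ n := by exact_mod_cast hqn
  have hn0 : (0 : ℝ) < n := lt_of_lt_of_le (by positivity) hqn'
  have hroot : (n : ℝ) ^ (1 / (k : ℝ)) ≤ q + 1 / k + 1 / (2 * q) := by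
    rw [one_div, Real.rpow_inv_le_iff_of_pos hn0.le (by positivity) hk0, Real.rpow_natCast]
    simpa using hn
  have hpow : (q : ℝ) ^ k / q ≤ (n : ℝ) ^ (1 - 1 / (k : ℝ)) := by
    have e : (q : ℝ) ^ k / q = ((q : ℝ) ^ k) ^ (1 - 1 / (k : ℝ)) := by
      rw [Real.rpow_sub (by positivity), Real.rpow_one, one_div,
        Real.pow_rpow_inv_natCast hq0.le (by omega)]
    rw [e]
    refine Real.rpow_le_rpow (by positivity) hqn' ?_
    rw [sub_nonneg, div_le_one hk0]
    exact_mod_cast hk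
  have hT' : ((q : ℝ) + 1) * n ≤ 2 * T + L := by exact_mod_cast hT
  have h1 : (n : ℝ) / (4 * q) + L / 2 ≤ (q : ℝ) ^ k / q := by
    rw [show (n : ℝ) / (4 * q) + L / 2 = (n + 2 * q * L) / 4 / q by
      field_simp; ring]
    gcongr
    linarith
  rw [Real.rpow_add hn0, Real.rpow_one]
  have h2 : 1 / 2 * ((n : ℝ) * (n : ℝ) ^ (1 / (k : ℝ))) ≤
      1 / 2 * (n * (q + 1 / k + 1 / (2 * q))) := by gcongr
  have h3 : 1 / 2 * ((n : ℝ) * (q + 1 / k + 1 / (2 * q))) + (k - 1) / (2 * k) * n =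
      1 / 2 * ((q + 1) * n) + n / (4 * q) := by
    field_simp; ring
  linarith

theorem exists_large_lower_bound {k : ℕ} (hk : k = 2 ∨ k = 3 ∨ k = 5) (N : ℕ) : ∃ n, N < n ∧
    1 / 2 * (n : ℝ) ^ (1 + 1 / (k : ℝ)) + ((k : ℝ) - 1) / (2 * (k : ℝ)) * (n : ℝ)
      - (n : ℝ) ^ (1 - 1 / (k : ℝ)) ≤
        (GraphFamily.turanNumber n (evenCyclesUpTo (2 * k) ∪ cyclesUpTo k) : ℝ) := by
  rcases hk with rfl | rfl | rfl
  · obtain ⟨q, hqN, hprime⟩ := Nat.exists_infinite_primes (N + 4)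
    have : Fact q.Prime := ⟨hprime⟩
    have h2 : (2 : ZMod q) ≠ 0 := by
      intro h
      have h' : ((2 : ℕ) : ZMod q) = 0 := by exact_mod_cast h
      rw [ZMod.natCast_eq_zero_iff] at h'
      have := Nat.le_of_dvd (by norm_num) h'
      omega
    have hq4 : (4 : ℝ) ≤ q := by exact_mod_cast (by omega : 4 ≤ q)
    refine ⟨1 + q + q ^ 2, by nlinarith, lower_bound_of_card (q := q) (by norm_num) (by omega)
      (le_turanNumber_of_odd_char h2 (ZMod.card q) rfl) (by omega) ?_ ?_⟩
    · push_cast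
      have : (0 : ℝ) ≤ 1 / (2 * q) := by positivity
      have e : (q : ℝ) * (1 / (2 * q)) = 1 / 2 := by field_simp
      nlinarith
    · push_cast
      nlinarith
  · obtain ⟨F, _, _, _, σ, hσ, hF⟩ := exists_field_with_sqrt_frobenius 2 (N + 4)
    obtain ⟨q, hq⟩ : ∃ q, Fintype.card F = q := ⟨_, rfl⟩
    rw [hq] at hF
    have hq4 : (4 : ℝ) ≤ q := by exact_mod_cast (by omega : 4 ≤ q)
    refine ⟨1 + q + q ^ 2 + q ^ 3, by nlinarith [sq_nonneg q, Nat.zero_le (q ^ 3)],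
      lower_bound_of_card (q := q) (by norm_num) (by omega)
      (le_turanNumber_of_char_two hσ hq rfl) (by omega) ?_ ?_⟩
    · push_cast
      rw [show (q : ℝ) + 1 / 3 + 1 / (2 * q) = (6 * q ^ 2 + 2 * q + 3) / (6 * q) by
        field_simp; ring, div_pow, le_div_iff₀ (by positivity), ← sub_nonneg]
      ring_nf
      positivity
    · push_cast
      nlinarith [mul_nonneg (by positivity : (0 : ℝ) ≤ q ^ 2) (sub_nonneg.2 hq4),
        mul_nonneg (by positivity : (0 : ℝ) ≤ q) (sub_nonneg.2 hq4)]
  · obtain ⟨F, _, _, _, σ, hσ, hF⟩ := exists_field_with_sqrt_frobenius 3 (N + 4)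
    obtain ⟨q, hq⟩ : ∃ q, Fintype.card F = q := ⟨_, rfl⟩
    rw [hq] at hF
    have hq4 : (4 : ℝ) ≤ q := by exact_mod_cast (by omega : 4 ≤ q)
    refine ⟨1 + q + q ^ 2 + q ^ 3 + q ^ 4 + q ^ 5, by
        have := Nat.zero_le (q ^ 2 + q ^ 3 + q ^ 4 + q ^ 5)
        omega,
      lower_bound_of_card (q := q) (by norm_num) (by omega)
      (le_turanNumber_of_char_three hσ hq rfl) (by omega) ?_ ?_⟩
    · push_cast
      rw [show (q : ℝ) + 1 / 5 + 1 / (2 * q) = (10 * q ^ 2 + 2 * q + 5) / (10 * q) by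
        field_simp; ring, div_pow, le_div_iff₀ (by positivity), ← sub_nonneg]
      ring_nf
      positivity
    · push_cast
      have h (j : ℕ) : (0 : ℝ) ≤ q ^ j * (q - 4) := mul_nonneg (by positivity) (by linarith)
      nlinarith [h 0, h 1, h 2, h 3, h 4]

theorem mainTheorem4 :
    (∀ k n : ℕ, 2 ≤ k → 1 ≤ n →
      (GraphFamily.turanNumber n (evenCyclesUpTo (2 * k) ∪ cyclesUpTo k) : ℝ) ≤
        1 / 2 * (n : ℝ) ^ (1 + 1 / (k : ℝ)) + ((k : ℝ) - 1) / (2 * (k : ℝ)) * (n : ℝ)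
          + (n : ℝ) ^ (1 - 1 / (k : ℝ))) ∧
    (∀ k : ℕ, (k = 2 ∨ k = 3 ∨ k = 5) →
      {n : ℕ | 1 / 2 * (n : ℝ) ^ (1 + 1 / (k : ℝ)) + ((k : ℝ) - 1) / (2 * (k : ℝ)) * (n : ℝ)
          - (n : ℝ) ^ (1 - 1 / (k : ℝ)) ≤
        (GraphFamily.turanNumber n (evenCyclesUpTo (2 * k) ∪ cyclesUpTo k) : ℝ)}.Infinite) := by
  refine ⟨fun k n hk hn => turanNumber_le_edgeBound (by omega) hn, fun k hk => ?_⟩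
  refine Set.infinite_of_forall_exists_gt fun N => ?_
  obtain ⟨n, hn, h⟩ := exists_large_lower_bound hk N
  exact ⟨n, h, hn⟩
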